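/- Let $\mathcal X$ be a finite set of arms and $P$ a finite set of priors, where $p\in P$ comes with a mean function $\mu_{1,p}:\mathcal X\to\mathbb R$ and a positive semidefinite kernel $k_{1,p}:\mathcal X\times\mathcal X\to\mathbb R$ with $k_{1,p}(x,x)\le 1$ for all $x$. Let $\sigma>0$, $\delta\in(0,1)$, $T\in\mathbb N$, let $p^*\in P$ be arbitrary and let $f\sim\mathcal{GP}(\mu_{1,p^*},k_{1,p^*})$. Selecting the arm $x_t$ in round $t$ yields the reward $y_t=f(x_t)+\epsilon_t$, where $\epsilon_1,\epsilon_2,\dots$ are i.i.d. $\mathcal N(0,\sigma^2)$ and $\epsilon_t$ is independent of $f$ and of everything up to and including the selection of round $t$. For $p\in P$ let $\mu_{t,p}$ and $k_{t,p}$ be the posterior mean and kernel given $(x_i,y_i)_{i<t}$, $$\mu_{t,p}(x)=\mu_{1,p}(x)+\mathbf k^\top(\mathbf K+\sigma^2I)^{-1}(\mathbf y-\boldsymbol\mu),\qquad k_{t,p}(x,\tilde x)=k_{1,p}(x,\tilde x)-\mathbf k^\top(\mathbf K+\sigma^2I)^{-1}\tilde{\mathbf k},$$ with $\mathbf k_i=k_{1,p}(x_i,x)$,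 $\tilde{\mathbf k}_i=k_{1,p}(x_i,\tilde x)$, $\mathbf K_{ij}=k_{1,p}(x_i,x_j)$, $\mathbf y_i=y_i$, $\boldsymbol\mu_i=\mu_{1,p}(x_i)$, and let $\sigma_{t,p}^2(x)=k_{t,p}(x,x)$. PE-GP-TS with parameters $(\beta_t),(\xi_t)$ starts with $P_1=P$ and in round $t=1,\dots,T$ does the following. Given the history, and using no other information on $f$, it draws independent $\tilde f_{t,p}\sim\mathcal{GP}(\mu_{t,p},k_{t,p})$ for $p\in P_t$; it selects $(x_t,p_t)$ maximising $\tilde f_{t,p}(x)$ over $(x,p)\in\mathcal X\times P_t$ (ties are broken in any way, possibly at random, that uses no further information on $f$; if $P_t=\emptyset$ the selection is arbitrary subject to the same restriction); it observes $y_t$. Put $\eta_t=y_t-\mu_{t,p_t}(x_t)$, $S_{t,p}=\{i\le t: p_i=p\}$ and $V_t=\sqrt{\xi_t|S_{t,p_t}|}+\sum_{i\in S_{t,p_t}}\sqrt{\beta_i}\,\sigma_{i,p_t}(x_i)$. If $\bigl|\sum_{i\in S_{t,p_t}}\eta_i\bigr|>V_t$, then $P_{t+1}=P_t\setminus\{p_t\}$;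 otherwise $P_{t+1}=P_t$. For a finite sequence $A=(a_1,\dots,a_n)$ of arms, repetitions allowed, let $I_p(\mathbf y_A;f)=H(\mathbf y_A\mid p)-H(\mathbf y_A\mid f,p)$ be the mutual information (difference of differential entropies) between $f\sim\mathcal{GP}(\mu_{1,p},k_{1,p})$ and observations of $f(a_1),\dots,f(a_n)$ with independent $\mathcal N(0,\sigma^2)$ noise. Let $\gamma_{T,p}=\sup_{|A|\le T}I_p(\mathbf y_A;f)$, where $|A|=n$ is the length, and $\hat\gamma_T=\max_{p\in P}\gamma_{T,p}$. Let $B_{p^*}=\beta_1+\sup_{x\in\mathcal X}|\mu_{1,p^*}(x)|$, $C=2/\log(1+\sigma^{-2})$, $x^*\in\arg\max_{x\in\mathcal X} f(x)$ and $R(T)=\sum_{t=1}^T\bigl(f(x^*)-f(x_t)\bigr)$. Then PE-GP-TS with $$\beta_t=2\log\frac{2|\mathcal X||P|\pi^2t^2}{3\delta},\qquad \xi_t=2\sigma^2\log\frac{|P|\pi^2t^2}{3\delta}$$ satisfies, with probability at least $1-\delta$ and for every choice of the maximiser $x^*$, $$R(T)\le 2|P|B_{p^*}+2\sqrt{\xi_T|P|T}+2\sqrt{C\,T\beta_T\hat\gamma_T|P|}+2\sqrt{T\beta_T\sum_{t=1}^T\sigma^2_{t,p^*}(x^*)}.$$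 -/

import Mathlib

open MeasureTheory ProbabilityTheory
open scoped Matrix

namespace PEGPTS

noncomputable section

/-! ### Gaussian processes on a finite set of arms -/

/-- The law `GP(m, k)` of a Gaussian process on a finite set of arms: the Gaussian measure on
`X → ℝ` with mean `m` and covariance `k` (for a positive semidefinite kernel `k`). -/
def gpLaw {X : Type*} [Fintype X] [DecidableEq X] (m : X → ℝ) (k : X → X → ℝ) :
    Measure (X → ℝ) :=
  (multivariateGaussian (WithLp.toLp 2 m) (Matrix.of k)).map WithLp.ofLp

/-- The regularised Gram matrix `K + σ² I` at the locations `a`. -/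
def noisyGram {X ι : Type*} [DecidableEq ι] (k : X → X → ℝ) (σ : ℝ) (a : ι → X) :
    Matrix ι ι ℝ :=
  Matrix.of (fun i j => k (a i) (a j)) + σ ^ 2 • (1 : Matrix ι ι ℝ)

/-- Posterior mean at `x` given observations `y i` at the locations `a i`. -/
def postMean {X ι : Type*} [Fintype ι] [DecidableEq ι] (m : X → ℝ) (k : X → X → ℝ) (σ : ℝ)
    (a : ι → X) (y : ι → ℝ) (x : X) : ℝ :=
  m x + (fun i => k (a i) x) ⬝ᵥ ((noisyGram k σ a)⁻¹ *ᵥ (fun i => y i - m (a i)))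

/-- Posterior kernel given observations at the locations `a i`. -/
def postKernel {X ι : Type*} [Fintype ι] [DecidableEq ι] (k : X → X → ℝ) (σ : ℝ)
    (a : ι → X) (x x' : X) : ℝ :=
  k x x' - (fun i => k (a i) x) ⬝ᵥ ((noisyGram k σ a)⁻¹ *ᵥ (fun i => k (a i) x'))

/-! ### Information gain -/

/-- The law of `n` independent centred Gaussian variables of variance `σ²`. -/
def noiseLaw (σ : ℝ) (n : ℕ) : Measure (Fin n → ℝ) :=
  Measure.pi fun _ => gaussianReal 0 (σ ^ 2).toNNReal

/-- Differential entropy `- ∫ φ log φ` of a measure on `ℝⁿ` with Lebesgue density `φ`. -/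
def diffEntropy {n : ℕ} (ν : Measure (Fin n → ℝ)) : ℝ :=
  ∫ y, Real.negMulLog ((ν.rnDeriv volume y).toReal)

/-- The law of the noisy observations `y i = f (a i) + e i` when `f ~ GP(m, k)`. -/
def obsLaw {X : Type*} [Fintype X] [DecidableEq X] (m : X → ℝ) (k : X → X → ℝ) (σ : ℝ)
    {n : ℕ} (a : Fin n → X) : Measure (Fin n → ℝ) :=
  ((gpLaw m k).prod (noiseLaw σ n)).map (fun q i => q.1 (a i) + q.2 i)

/-- The conditional law of the noisy observations `y i = f (a i) + e i` given `f`. -/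
def obsLawGiven {X : Type*} (f : X → ℝ) (σ : ℝ) {n : ℕ} (a : Fin n → X) :
    Measure (Fin n → ℝ) :=
  (noiseLaw σ n).map (fun e i => f (a i) + e i)

/-- Mutual information `I(y_A; f) = H(y_A) - H(y_A | f)` for `f ~ GP(m, k)`. -/
def infoGain {X : Type*} [Fintype X] [DecidableEq X] (m : X → ℝ) (k : X → X → ℝ) (σ : ℝ)
    {n : ℕ} (a : Fin n → X) : ℝ :=
  diffEntropy (obsLaw m k σ a) - ∫ f, diffEntropy (obsLawGiven f σ a) ∂(gpLaw m k)

/-- Maximal information gain `γ_T` over at most `T` queries; an arm may be queried repeatedly.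
The supremum is over a finite non-empty index type. -/
def maxInfoGain {X : Type*} [Fintype X] [DecidableEq X] (m : X → ℝ) (k : X → X → ℝ) (σ : ℝ)
    (T : ℕ) : ℝ :=
  ⨆ A : (Σ n : Fin (T + 1), (Fin n → X)), infoGain m k σ A.2

/-- Worst-case maximal information gain `max_p γ_{T,p}`. -/
def worstInfoGain {X P : Type*} [Fintype X] [DecidableEq X] (μ : P → X → ℝ)
    (k : P → X → X → ℝ) (σ : ℝ) (T : ℕ) : ℝ :=
  ⨆ p, maxInfoGain (μ p) (k p) σ T

/-! ### The bandit process -/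

/-- The random quantities of a run: the expected reward function, the noise, the sampled
functions, the selected arms and the selected priors. Rounds are numbered from `1`. -/
structure Bandit (Ω X P : Type*) where
  /-- the expected reward function `f` -/
  f : Ω → X → ℝ
  /-- the noise `ε_t` -/
  noise : ℕ → Ω → ℝ
  /-- the sampled functions `f̃_{t,p}` -/
  sample : ℕ → Ω → P → X → ℝ
  /-- the selected arm `x_t` -/
  arm : ℕ → Ω → X
  /-- the selected prior `p_t` -/
  prior : ℕ → Ω → P

namespace Bandit

variable {Ω X P : Type*}

/-- The observed reward `y_t = f(x_t) + ε_t`. -/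
def reward (A : Bandit Ω X P) (t : ℕ) (ω : Ω) : ℝ :=
  A.f ω (A.arm t ω) + A.noise t ω

/-- The cumulative regret against a comparator arm `xs` (a maximiser of `f`). -/
def regret (A : Bandit Ω X P) (T : ℕ) (xs : X) (ω : Ω) : ℝ :=
  ∑ t ∈ Finset.Icc 1 T, (A.f ω xs - A.f ω (A.arm t ω))

/-- `μ_{t,p}`: posterior mean for prior `p` given the rounds `1, …, t - 1`. -/
def mean (A : Bandit Ω X P) (μ : P → X → ℝ) (k : P → X → X → ℝ) (σ : ℝ)
    (t : ℕ) (p : P) (ω : Ω) : X → ℝ :=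
  postMean (μ p) (k p) σ (fun i : Finset.Ico 1 t => A.arm i ω)
    (fun i : Finset.Ico 1 t => A.reward i ω)

/-- `k_{t,p}`: posterior kernel for prior `p` given the rounds `1, …, t - 1`. -/
def kernel (A : Bandit Ω X P) (k : P → X → X → ℝ) (σ : ℝ)
    (t : ℕ) (p : P) (ω : Ω) : X → X → ℝ :=
  postKernel (k p) σ (fun i : Finset.Ico 1 t => A.arm i ω)

/-- `σ²_{t,p}(x) = k_{t,p}(x, x)`. -/
def var (A : Bandit Ω X P) (k : P → X → X → ℝ) (σ : ℝ)
    (t : ℕ) (p : P) (ω : Ω) (x : X) : ℝ :=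
  A.kernel k σ t p ω x x

/-- `S_{t,p}`: the rounds up to and including `t` in which prior `p` was selected. -/
def rounds [DecidableEq P] (A : Bandit Ω X P) (t : ℕ) (p : P) (ω : Ω) : Finset ℕ :=
  (Finset.Icc 1 t).filter (fun i => A.prior i ω = p)

/-- The prediction error `η_t = y_t - μ_{t,p_t}(x_t)`. -/
def predError (A : Bandit Ω X P) (μ : P → X → ℝ) (k : P → X → X → ℝ) (σ : ℝ)
    (t : ℕ) (ω : Ω) : ℝ :=
  A.reward t ω - A.mean μ k σ t (A.prior t ω) ω (A.arm t ω)

/-- The threshold `V_t`. -/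
def threshold [DecidableEq P] (A : Bandit Ω X P) (k : P → X → X → ℝ) (σ : ℝ) (β ξ : ℕ → ℝ)
    (t : ℕ) (ω : Ω) : ℝ :=
  √(ξ t * (A.rounds t (A.prior t ω) ω).card) +
    ∑ i ∈ A.rounds t (A.prior t ω) ω,
      √(β i) * √(A.var k σ i (A.prior t ω) ω (A.arm i ω))

/-- The elimination criterion of round `t`. -/
def Eliminates [DecidableEq P] (A : Bandit Ω X P) (μ : P → X → ℝ) (k : P → X → X → ℝ) (σ : ℝ)
    (β ξ : ℕ → ℝ) (t : ℕ) (ω : Ω) : Prop :=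
  A.threshold k σ β ξ t ω < |∑ i ∈ A.rounds t (A.prior t ω) ω, A.predError μ k σ i ω|

open Classical in
/-- `P_t`: the priors that are active at the start of round `t`; `P_1` holds all priors. -/
def active [Fintype P] [DecidableEq P] (A : Bandit Ω X P) (μ : P → X → ℝ) (k : P → X → X → ℝ)
    (σ : ℝ) (β ξ : ℕ → ℝ) (ω : Ω) : ℕ → Finset P
  | 0 => Finset.univ
  | 1 => Finset.univ
  | t + 2 =>
    if A.Eliminates μ k σ β ξ (t + 1) ω then
      (A.active μ k σ β ξ ω (t + 1)).erase (A.prior (t + 1) ω)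
    else A.active μ k σ β ξ ω (t + 1)

/-- The σ-algebra generated by `f`. -/
abbrev truthAlg (A : Bandit Ω X P) : MeasurableSpace Ω :=
  MeasurableSpace.comap A.f inferInstance

/-- The σ-algebra generated by the functions sampled in round `t`. -/
abbrev sampleAlg (A : Bandit Ω X P) (t : ℕ) : MeasurableSpace Ω :=
  MeasurableSpace.comap (A.sample t) inferInstance

/-- The σ-algebra generated by the arm and the prior selected in round `t`. -/
abbrev choiceAlg (A : Bandit Ω X P) (t : ℕ) : MeasurableSpace Ω :=
  MeasurableSpace.comap (fun ω => (A.arm t ω, A.prior t ω)) ⊤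

/-- What the agent has seen before round `t`: the samples, selections and rewards of the rounds
`1, …, t - 1`. -/
abbrev history (A : Bandit Ω X P) (t : ℕ) : MeasurableSpace Ω :=
  ⨆ i ∈ Finset.Ico 1 t,
    A.sampleAlg i ⊔ A.choiceAlg i ⊔ MeasurableSpace.comap (A.reward i) inferInstance

end Bandit

/-- `A` is a run of PE-GP-TS over `T` rounds with inputs `μ, k, β, ξ` and noise level `σ`, in the
environment where the expected reward function is drawn from the prior `pstar`. -/
structure IsRun {Ω X P : Type*} [Fintype X] [DecidableEq X] [Fintype P] [DecidableEq P]
    [MeasurableSpace Ω] (Pr : Measure Ω) (μ : P → X → ℝ) (k : P → X → X → ℝ) (σ : ℝ)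
    (β ξ : ℕ → ℝ) (T : ℕ) (pstar : P) (A : Bandit Ω X P) : Prop where
  measurable_f : Measurable A.f
  measurable_noise : ∀ t ∈ Finset.Icc 1 T, Measurable (A.noise t)
  measurable_sample : ∀ t ∈ Finset.Icc 1 T, Measurable (A.sample t)
  measurable_choice : ∀ t ∈ Finset.Icc 1 T, ∀ x p,
    MeasurableSet {ω | A.arm t ω = x ∧ A.prior t ω = p}
  /-- `f ~ GP(μ_{1,p*}, k_{1,p*})`. -/
  law_f : Pr.map A.f = gpLaw (μ pstar) (k pstar)
  /-- The noise is `N(0, σ²)`. -/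
  law_noise : ∀ t ∈ Finset.Icc 1 T, Pr.map (A.noise t) = gaussianReal 0 (σ ^ 2).toNNReal
  /-- The noise of round `t` is independent of `f` and of everything that happened before the
  reward of round `t` was observed, in particular of the noise of the earlier rounds. -/
  indep_noise : ∀ t ∈ Finset.Icc 1 T,
    Indep (MeasurableSpace.comap (A.noise t) inferInstance)
      (A.history t ⊔ A.sampleAlg t ⊔ A.choiceAlg t ⊔ A.truthAlg) Pr
  /-- Given the history, the functions `f̃_{t,p}` are drawn from `GP(μ_{t,p}, k_{t,p})`,
  independently over `p`, by means of randomness that carries no information on `f`.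
  (Draws for priors that are no longer active are never looked at by the algorithm.) -/
  law_sample : ∀ t ∈ Finset.Icc 1 T, ∀ B : Set (P → X → ℝ), MeasurableSet B →
    Pr⟦A.sample t ⁻¹' B | A.history t ⊔ A.truthAlg⟧ =ᵐ[Pr] fun ω =>
      (Measure.pi fun p => gpLaw (A.mean μ k σ t p ω) (A.kernel k σ t p ω)).real B
  /-- The selected pair maximises `f̃_{t,p}(x)` over all arms and all active priors. -/
  selection : ∀ t ∈ Finset.Icc 1 T, ∀ᵐ ω ∂Pr, (A.active μ k σ β ξ ω t).Nonempty →
    A.prior t ω ∈ A.active μ k σ β ξ ω t ∧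
      ∀ p ∈ A.active μ k σ β ξ ω t, ∀ x,
        A.sample t ω p x ≤ A.sample t ω (A.prior t ω) (A.arm t ω)
  /-- Ties are broken (possibly at random) without knowledge of `f` beyond the history. -/
  tie_breaking : ∀ t ∈ Finset.Icc 1 T, ∀ x p,
    Pr⟦{ω | A.arm t ω = x ∧ A.prior t ω = p} |
        A.history t ⊔ A.sampleAlg t ⊔ A.truthAlg⟧ =ᵐ[Pr]
      Pr⟦{ω | A.arm t ω = x ∧ A.prior t ω = p} | A.history t ⊔ A.sampleAlg t⟧

/-! ### The parameters of the regret bound -/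

/-- `β_t = 2 log (2 |X| |P| π² t² / (3 δ))`. -/
def beta (X P : Type*) [Fintype X] [Fintype P] (δ : ℝ) (t : ℕ) : ℝ :=
  2 * Real.log (2 * Fintype.card X * Fintype.card P * Real.pi ^ 2 * t ^ 2 / (3 * δ))

/-- `ξ_t = 2 σ² log (|P| π² t² / (3 δ))`. -/
def xi (P : Type*) [Fintype P] (σ δ : ℝ) (t : ℕ) : ℝ :=
  2 * σ ^ 2 * Real.log (Fintype.card P * Real.pi ^ 2 * t ^ 2 / (3 * δ))

end

end PEGPTS

namespace PEGPTS

noncomputable section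


/-! ### Gaussian laws on a finite set of arms -/

section GaussianLaws

variable {X : Type*} [Fintype X] [DecidableEq X]

/-! The proof separates a deterministic regret estimate, valid wherever certain confidence bounds
hold (`Bandit.Confident`), from the proof that these bounds fail with probability at most `δ`.

Deterministic part. If the posterior mean of `pstar` is within `√β σ` of `f` and the noise sums are
small, the prediction errors of `pstar` stay below the threshold, so `pstar` is never eliminated.
Its sample therefore always competes in the maximisation: `f(x*)` is at most the sample of `pstar`
at `x*` plus two confidence widths, hence at most the winning sample plus these widths. The winning
sample is close to `μ_{t,p_t}(x_t) = f(x_t) + ε_t - η_t`. Summed over the surviving rounds of one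
prior, the `η_t` are controlled because the elimination test was passed in the last such round, and
the `ε_t` by concentration. At most `|P|` rounds eliminate a prior, and each costs at most `2 B`.
Cauchy-Schwarz, over rounds and then over priors, gives the square roots
(`Bandit.Confident.regret_le`). The widths at the queried arms are summed through the information
gain: adding one observation multiplies `det (K + σ² I)` by `σ² + σ_t²(x_t)`, so the gain is `½ ∑
log (1 + σ_t²/σ²)`, and concavity of the logarithm compares this with `∑ σ_t²`
(`sum_postKernel_le`).

Probabilistic part. Although the arms are chosen adaptively, `f - μ_{t,pstar}` is, given the
history, a centred Gaussian process with the posterior kernel (`IsRun.residual_law`). The induction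
step uses that the samples and the selection carry no further information on `f`, and that for a
fixed arm the new residual is independent of the innovation `y_t - μ_t(x_t)`
(`map_innovation_residual`). Samples are Gaussian by assumption. For the noise, a martingale
argument treats the first `n` selections of a prior as if they were `n` independent terms
(`measure_predictable_sum_le`). A union bound with weights `1/t²` completes the proof. -/

instance isGaussian_gpLaw (m : X → ℝ) (k : X → X → ℝ) : IsGaussian (gpLaw m k) := by
  have h : gpLaw m k = (multivariateGaussian (WithLp.toLp 2 m) (Matrix.of k)).map
      (PiLp.continuousLinearEquiv 2 ℝ (fun _ : X => ℝ)) := rfl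
  rw [h]
  infer_instance

omit [Fintype X] [DecidableEq X] in
theorem aestronglyMeasurable_eval (ν : Measure (X → ℝ)) (x : X) :
    AEStronglyMeasurable (fun r : X → ℝ => r x) ν :=
  (measurable_pi_apply x).aestronglyMeasurable

theorem integral_eval_gpLaw (m : X → ℝ) (k : X → X → ℝ) (x : X) :
    ∫ r, r x ∂(gpLaw m k) = m x := by
  rw [gpLaw, integral_map (by fun_prop) (aestronglyMeasurable_eval _ x)]
  have h := (EuclideanSpace.proj (𝕜 := ℝ) x).integral_comp_comm
    (IsGaussian.integrable_fun_id
      (μ := multivariateGaussian (WithLp.toLp 2 m) (Matrix.of k)))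
  simpa using h

theorem covariance_eval_gpLaw (m : X → ℝ) {k : X → X → ℝ} (hk : (Matrix.of k).PosSemidef)
    (x x' : X) : cov[fun r => r x, fun r => r x'; gpLaw m k] = k x x' := by
  rw [gpLaw, covariance_map (aestronglyMeasurable_eval _ x)
    (aestronglyMeasurable_eval _ x') (by fun_prop)]
  exact covariance_eval_multivariateGaussian hk x x'

theorem map_eval_gpLaw (m : X → ℝ) {k : X → X → ℝ} (hk : (Matrix.of k).PosSemidef) (x : X) :
    (gpLaw m k).map (fun r => r x) = gaussianReal (m x) (k x x).toNNReal := by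
  rw [gpLaw, Measure.map_map (by fun_prop) (by fun_prop)]
  exact (measurePreserving_eval_multivariateGaussian hk (i := x)).map_eq

omit [DecidableEq X] in
theorem memLp_eval_of_isGaussian (ν : Measure (X → ℝ)) [IsGaussian ν] (x : X) :
    MemLp (fun r => r x) 2 ν :=
  IsGaussian.memLp_dual ν (ContinuousLinearMap.proj x) 2 (by simp)

/-- Gaussian measures on `X → ℝ` are determined by the means and covariances of the
coordinates. -/
theorem isGaussian_pi_ext (ν₁ ν₂ : Measure (X → ℝ)) [IsGaussian ν₁] [IsGaussian ν₂]
    (hm : ∀ x, ∫ r, r x ∂ν₁ = ∫ r, r x ∂ν₂)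
    (hc : ∀ x x', cov[fun r => r x, fun r => r x'; ν₁] = cov[fun r => r x, fun r => r x'; ν₂]) :
    ν₁ = ν₂ := by
  apply Measure.ext_of_charFunDual
  ext L
  obtain ⟨c, hL⟩ : ∃ c : X → ℝ, (L : (X → ℝ) → ℝ) = fun r => ∑ x, c x * r x := by
    refine ⟨fun x => L (Pi.single x 1), ?_⟩
    ext r
    conv_lhs => rw [pi_eq_sum_univ' r]
    simp [map_sum, mul_comm]
  have key : ∀ ν : Measure (X → ℝ), IsGaussian ν → ν[L] = ∑ x, c x * ∫ r, r x ∂ν ∧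
      Var[L; ν] = ∑ x, ∑ x', c x * (c x' *
        cov[fun r => r x, fun r => r x'; ν]) := by
    intro ν hν
    have hmeas : ∀ x, MemLp (fun r : X → ℝ => c x * r x) 2 ν := fun x =>
      (memLp_eval_of_isGaussian ν x).const_mul _
    rw [hL]
    constructor
    · rw [integral_finsetSum]
      · simp [integral_const_mul]
      · exact fun x _ => (hmeas x).integrable (by norm_num)
    · rw [← covariance_self (memLp_finsetSum _ fun x _ => hmeas x).aestronglyMeasurable.aemeasurable,
        covariance_fun_sum_fun_sum hmeas hmeas]
      simp [covariance_const_mul_left, covariance_const_mul_right, mul_left_comm]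
  rw [IsGaussian.charFunDual_eq, IsGaussian.charFunDual_eq]
  have h1 := key ν₁ inferInstance
  have h2 := key ν₂ inferInstance
  simp only [integral_complex_ofReal, h1.1, h1.2, h2.1, h2.2, hm, hc]

theorem eq_gpLaw_of_isGaussian (ν : Measure (X → ℝ)) [IsGaussian ν] (m : X → ℝ) {k : X → X → ℝ}
    (hk : (Matrix.of k).PosSemidef) (hm : ∀ x, ∫ r, r x ∂ν = m x)
    (hc : ∀ x x', cov[fun r => r x, fun r => r x'; ν] = k x x') : ν = gpLaw m k :=
  isGaussian_pi_ext _ _ (fun x => by rw [hm, integral_eval_gpLaw])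
    (fun x x' => by rw [hc, covariance_eval_gpLaw m hk])

/-- Translating a Gaussian process translates its mean. -/
theorem map_sub_gpLaw (m : X → ℝ) {k : X → X → ℝ} (hk : (Matrix.of k).PosSemidef) :
    (gpLaw m k).map (fun r => r - m) = gpLaw 0 k := by
  have hmeas : Measurable (fun r : X → ℝ => r - m) := by fun_prop
  apply eq_gpLaw_of_isGaussian _ _ hk
  · intro x
    rw [integral_map hmeas.aemeasurable (aestronglyMeasurable_eval _ x)]
    simp only [Pi.sub_apply]
    rw [integral_sub ((memLp_eval_of_isGaussian _ x).integrable (by norm_num))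
      (integrable_const _), integral_eval_gpLaw]
    simp
  · intro x x'
    rw [covariance_map (aestronglyMeasurable_eval _ x)
      (aestronglyMeasurable_eval _ x') hmeas.aemeasurable]
    simp only [Function.comp_def, Pi.sub_apply]
    rw [covariance_sub_const_left ((memLp_eval_of_isGaussian _ x).integrable (by norm_num)),
      covariance_sub_const_right ((memLp_eval_of_isGaussian _ x').integrable (by norm_num)),
      covariance_eval_gpLaw m hk]

/-- Observing `r b + e` with `r ~ GP(0, k)` and independent noise `e ~ N(0, v)`: the observation and
the residual of its regression on `r` are independent Gaussian. -/
theorem map_innovation_residual {k : X → X → ℝ} (hk : (Matrix.of k).PosSemidef) (v : NNReal)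
    (hv : v ≠ 0) (b : X) {k' : X → X → ℝ} (hk' : (Matrix.of k').PosSemidef)
    (hkk : ∀ x x', k' x x' = k x x' - k x b / (k b b + v) * k b x') :
    ((gpLaw 0 k).prod (gaussianReal 0 v)).map
        (fun q => (q.1 b + q.2, fun x => q.1 x - k x b / (k b b + v) * (q.1 b + q.2))) =
      (((gpLaw 0 k).prod (gaussianReal 0 v)).map (fun q => q.1 b + q.2)).prod (gpLaw 0 k') := by
  set Q : Measure ((X → ℝ) × ℝ) := (gpLaw 0 k).prod (gaussianReal 0 v) with hQ
  have hkb : 0 ≤ k b b := by simpa using hk.diag_nonneg (i := b)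
  have hpos : 0 < k b b + (v : ℝ) := by positivity
  have hsymm : ∀ x x', k x x' = k x' x := fun x x' => by
    simpa using hk.isHermitian.apply x' x
  have m1 : ∀ x, MemLp (fun q : (X → ℝ) × ℝ => q.1 x) 2 Q := fun x =>
    (memLp_eval_of_isGaussian (gpLaw 0 k) x).comp_measurePreserving measurePreserving_fst
  have m2 : MemLp (fun q : (X → ℝ) × ℝ => q.2) 2 Q :=
    (memLp_id_gaussianReal' (μ := 0) (v := v) 2 (by simp)).comp_measurePreserving
      measurePreserving_snd
  have c11 : ∀ x x', cov[fun q => q.1 x, fun q => q.1 x'; Q] = k x x' := by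
    intro x x'
    have h := covariance_map (μ := Q) (Z := Prod.fst) (X := fun r : X → ℝ => r x)
      (Y := fun r : X → ℝ => r x') (aestronglyMeasurable_eval _ x)
      (aestronglyMeasurable_eval _ x') (by fun_prop)
    rw [hQ, measurePreserving_fst.map_eq, covariance_eval_gpLaw 0 hk] at h
    exact h.symm
  have c12 : ∀ x, cov[fun q => q.1 x, fun q => q.2; Q] = 0 := by
    intro x
    apply IndepFun.covariance_eq_zero _ (m1 x) m2
    exact indepFun_prod (X := fun r : X → ℝ => r x) (Y := fun e : ℝ => e) (by fun_prop)
      (by fun_prop)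
  have c21 : ∀ x, cov[fun q => q.2, fun q => q.1 x; Q] = 0 := fun x => by
    rw [covariance_comm, c12]
  have c22 : cov[fun q => q.2, fun q => q.2; Q] = v := by
    have h := covariance_map (μ := Q) (Z := Prod.snd) (X := fun r : ℝ => r)
      (Y := fun r : ℝ => r) (by fun_prop) (by fun_prop) (by fun_prop)
    rw [hQ, measurePreserving_snd.map_eq, covariance_self (by fun_prop),
      variance_fun_id_gaussianReal] at h
    exact h.symm
  have mρ : MemLp (fun q : (X → ℝ) × ℝ => q.1 b + q.2) 2 Q := (m1 b).add m2
  have cρ : ∀ x, cov[fun q => q.1 b + q.2, fun q => q.1 x; Q] = k b x := fun x => by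
    rw [show (fun q : (X → ℝ) × ℝ => q.1 b + q.2) = (fun q => q.1 b) + fun q => q.2 from rfl,
      covariance_add_left (m1 b) m2 (m1 x), c11, c21, add_zero]
  have cρρ : cov[fun q => q.1 b + q.2, fun q => q.1 b + q.2; Q] = k b b + v := by
    rw [show (fun q : (X → ℝ) × ℝ => q.1 b + q.2) = (fun q => q.1 b) + fun q => q.2 from rfl,
      covariance_add_left (m1 b) m2 ((m1 b).add m2), covariance_add_right (m1 b) (m1 b) m2,
      covariance_add_right m2 (m1 b) m2, c11, c12, c21, c22]
    ring
  have mg : ∀ x, MemLp (fun q : (X → ℝ) × ℝ => k x b / (k b b + v) * (q.1 b + q.2)) 2 Q :=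
    fun x => mρ.const_mul _
  have mres : ∀ x, MemLp (fun q : (X → ℝ) × ℝ => q.1 x - k x b / (k b b + v) * (q.1 b + q.2)) 2 Q :=
    fun x => (m1 x).sub (mg x)
  -- The coefficient `k x b / (k b b + v)` is the one that makes the residual uncorrelated with the
  -- observation; joint Gaussianity turns this into independence.
  have cres : ∀ x, cov[fun q => q.1 b + q.2,
      fun q => q.1 x - k x b / (k b b + v) * (q.1 b + q.2); Q] = 0 := by
    intro x
    rw [covariance_fun_sub_right (Y := fun q => q.1 x) mρ (m1 x) (mg x), cρ,
      covariance_const_mul_right, cρρ,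
      hsymm b x]
    field_simp
    ring
  -- Joint Gaussianity holds because observation and residual form one linear image of `(r, e)`. The
  -- observation is viewed as a family over `Unit` to fit the independence criterion for families.
  let L : ((X → ℝ) × ℝ) →L[ℝ] (Unit → ℝ) × (X → ℝ) :=
    (ContinuousLinearMap.pi fun _ => (ContinuousLinearMap.proj b).comp
        (ContinuousLinearMap.fst ℝ (X → ℝ) ℝ) + ContinuousLinearMap.snd ℝ (X → ℝ) ℝ).prod
      (ContinuousLinearMap.pi fun x => (ContinuousLinearMap.proj x).comp
        (ContinuousLinearMap.fst ℝ (X → ℝ) ℝ) - (k x b / (k b b + v)) •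
        ((ContinuousLinearMap.proj b).comp
        (ContinuousLinearMap.fst ℝ (X → ℝ) ℝ) + ContinuousLinearMap.snd ℝ (X → ℝ) ℝ))
  have hG : HasGaussianLaw (fun q : (X → ℝ) × ℝ => ((fun _ : Unit => q.1 b + q.2),
      fun x => q.1 x - k x b / (k b b + v) * (q.1 b + q.2))) Q :=
    (IsGaussian.hasGaussianLaw_id (μ := Q)).map L
  have hI := hG.indepFun_of_covariance_eval (X := fun _ (q : (X → ℝ) × ℝ) => q.1 b + q.2)
    (Y := fun x (q : (X → ℝ) × ℝ) => q.1 x - k x b / (k b b + v) * (q.1 b + q.2)) (fun _ x => cres x)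
  have hI' : IndepFun (fun q : (X → ℝ) × ℝ => q.1 b + q.2)
      (fun q x => q.1 x - k x b / (k b b + v) * (q.1 b + q.2)) Q :=
    hI.comp (measurable_pi_apply ()) measurable_id
  rw [(indepFun_iff_map_prod_eq_prod_map_map (by fun_prop) (by fun_prop)).1 hI']
  congr 1
  have hGs := hG.snd.isGaussian_map
  apply eq_gpLaw_of_isGaussian _ _ hk'
  · intro x
    rw [integral_map (by fun_prop) (aestronglyMeasurable_eval _ x)]
    have i1 : ∀ x, ∫ q, q.1 x ∂Q = 0 := fun x => by
      have h := integral_map (μ := Q) (φ := Prod.fst) (f := fun r : X → ℝ => r x)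
        (by fun_prop) (aestronglyMeasurable_eval _ x)
      rw [hQ, measurePreserving_fst.map_eq, integral_eval_gpLaw] at h
      exact h.symm
    have i2 : ∫ q, q.2 ∂Q = 0 := by
      have h := integral_map (μ := Q) (φ := Prod.snd) (f := fun r : ℝ => r)
        (by fun_prop) (by fun_prop)
      rw [hQ, measurePreserving_snd.map_eq, integral_id_gaussianReal] at h
      exact h.symm
    rw [integral_sub ((m1 x).integrable (by norm_num)) ((mg x).integrable (by norm_num)),
      integral_const_mul, integral_add ((m1 b).integrable (by norm_num))
        (m2.integrable (by norm_num)), i1, i1, i2]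
    simp
  · intro x x'
    rw [covariance_map (aestronglyMeasurable_eval _ x) (aestronglyMeasurable_eval _ x')
      (by fun_prop)]
    simp only [Function.comp_def]
    rw [covariance_fun_sub_left (X := fun q => q.1 x) (m1 x) (mg x) (mres x'),
      covariance_const_mul_left, cres,
      covariance_fun_sub_right (Y := fun q => q.1 x') (m1 x) (m1 x') (mg x'), c11,
      covariance_const_mul_right, covariance_comm, cρ, hkk, hsymm b x, hsymm b x']
    ring

end GaussianLaws

/-! ### Gaussian tails -/

/-- For `z ≥ c ≥ 0` one has `z² ≥ c² + (z - c)²`, so beyond `c` the density is at most `exp (-c²/2)`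
times the density translated by `c`. -/
theorem gaussianReal_Ioi_le {c : ℝ} (hc : 0 ≤ c) :
    gaussianReal 0 1 (Set.Ioi c) ≤
      ENNReal.ofReal (Real.exp (-c ^ 2 / 2)) * gaussianReal 0 1 (Set.Ioi 0) := by
  have h1 : gaussianReal 0 1 (Set.Ioi 0) = gaussianReal c 1 (Set.Ioi c) := by
    have h := gaussianReal_map_add_const (μ := 0) (v := 1) c
    rw [zero_add] at h
    rw [← h, Measure.map_apply (by fun_prop) measurableSet_Ioi]
    congr 1
    ext z
    simp
  rw [h1, gaussianReal_apply _ one_ne_zero, gaussianReal_apply _ one_ne_zero,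
    ← lintegral_const_mul _ (measurable_gaussianPDF _ _)]
  refine setLIntegral_mono ((measurable_gaussianPDF _ _).const_mul _) fun z hz => ?_
  rw [gaussianPDF, gaussianPDF, ← ENNReal.ofReal_mul (Real.exp_nonneg _)]
  apply ENNReal.ofReal_le_ofReal
  rw [gaussianPDFReal, gaussianPDFReal, mul_left_comm, ← Real.exp_add]
  gcongr
  have hz' : c < z := hz
  simp only [NNReal.coe_one, mul_one, sub_zero]
  nlinarith [mul_nonneg hc (sub_nonneg.2 hz'.le)]

/-- Keeping the factor `P(Z > 0)` in the one-sided bound pays off here: the two tails together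
contribute `2 P(Z > 0) ≤ 1`, so no factor 2 is lost. The constants in `beta` and `xi` depend on
this. -/
theorem gaussianReal_zero_one_tail {c : ℝ} (hc : 0 ≤ c) :
    gaussianReal 0 1 {z | c < |z|} ≤ ENNReal.ofReal (Real.exp (-c ^ 2 / 2)) := by
  have hneg : ∀ a : ℝ, gaussianReal 0 1 (Set.Iio (-a)) = gaussianReal 0 1 (Set.Ioi a) := by
    intro a
    have h := gaussianReal_map_neg (μ := 0) (v := 1)
    rw [neg_zero] at h
    conv_rhs => rw [← h]
    rw [Measure.map_apply (by fun_prop) measurableSet_Ioi]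
    congr 1
    ext z
    simp
  have hset : {z : ℝ | c < |z|} = Set.Ioi c ∪ Set.Iio (-c) := by
    ext z
    simp [lt_abs, lt_neg]
  have hone : gaussianReal 0 1 (Set.Ioi 0) + gaussianReal 0 1 (Set.Ioi 0) ≤ 1 := by
    nth_rewrite 2 [← hneg 0]
    rw [neg_zero, ← measure_union (Set.disjoint_left.2 fun z h1 h2 =>
      lt_asymm (Set.mem_Ioi.1 h1) (Set.mem_Iio.1 h2)) measurableSet_Iio]
    exact prob_le_one
  calc gaussianReal 0 1 {z | c < |z|}
      ≤ gaussianReal 0 1 (Set.Ioi c) + gaussianReal 0 1 (Set.Iio (-c)) := by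
        rw [hset]; exact measure_union_le _ _
    _ ≤ ENNReal.ofReal (Real.exp (-c ^ 2 / 2)) *
        (gaussianReal 0 1 (Set.Ioi 0) + gaussianReal 0 1 (Set.Ioi 0)) := by
        rw [hneg, mul_add]
        gcongr <;> exact gaussianReal_Ioi_le hc
    _ ≤ ENNReal.ofReal (Real.exp (-c ^ 2 / 2)) := mul_le_of_le_one_right' hone

/-- The two-sided Gaussian tail bound `P(|Y - m| > c √v) ≤ exp (- c² / 2)`. -/
theorem gaussianReal_tail (m : ℝ) (v : NNReal) {c : ℝ} (hc : 0 ≤ c) :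
    gaussianReal m v {y | c * √v < |y - m|} ≤ ENNReal.ofReal (Real.exp (-c ^ 2 / 2)) := by
  have hmeas : MeasurableSet {y : ℝ | c * √v < |y - m|} :=
    measurableSet_lt (by fun_prop) (by fun_prop)
  have h1 : (gaussianReal 0 1).map (fun z => √v * z) = gaussianReal 0 v := by
    rw [gaussianReal_map_const_mul, mul_zero]
    congr 1
    apply NNReal.coe_injective
    simp
  have h2 := gaussianReal_map_add_const (μ := 0) (v := v) m
  rw [← h1, zero_add, Measure.map_map (by fun_prop) (by fun_prop)] at h2
  rw [← h2, Measure.map_apply (by fun_prop) hmeas]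
  refine (measure_mono fun z hz => ?_).trans (gaussianReal_zero_one_tail hc)
  simp only [Set.mem_preimage, Function.comp_apply, Set.mem_ofPred_eq, add_sub_cancel_right,
    abs_mul, abs_of_nonneg (Real.sqrt_nonneg _)] at hz ⊢
  by_contra hcon
  rw [not_lt] at hcon
  nlinarith [mul_le_mul_of_nonneg_left hcon (Real.sqrt_nonneg (v : ℝ))]


/-! ### Updating the posterior with one observation -/

section Posterior

variable {X ι κ : Type*} [Fintype ι] [DecidableEq ι] [Fintype κ] [DecidableEq κ]

theorem kernel_symm {k : X → X → ℝ} (hk : (Matrix.of k).PosSemidef) (x x' : X) :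
    k x x' = k x' x := by
  simpa using hk.isHermitian.apply x' x

omit [Fintype ι] in
theorem posDef_noisyGram [Finite X] {k : X → X → ℝ} (hk : (Matrix.of k).PosSemidef) {σ : ℝ}
    (hσ : 0 < σ)
    (a : ι → X) : (noisyGram k σ a).PosDef := by
  have h1 : (Matrix.of fun i j => k (a i) (a j)).PosSemidef := hk.submatrix a
  have h2 : (σ ^ 2 • (1 : Matrix ι ι ℝ)).PosDef := Matrix.PosDef.one.smul (by positivity)
  exact Matrix.PosDef.posSemidef_add h1 h2

omit [Fintype ι] in
theorem noisyGram_transpose {k : X → X → ℝ} (hk : (Matrix.of k).PosSemidef) (σ : ℝ) (a : ι → X) :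
    (noisyGram k σ a)ᵀ = noisyGram k σ a := by
  ext i j
  simp [noisyGram, kernel_symm hk (a i) (a j), Matrix.one_apply, eq_comm]

omit [Fintype ι] [Fintype κ] in
theorem noisyGram_comp (k : X → X → ℝ) (σ : ℝ) (a : ι → X) (e : κ ≃ ι) :
    noisyGram k σ (a ∘ e) = (noisyGram k σ a).submatrix e e := by
  ext i j
  simp [noisyGram, Matrix.one_apply]

/-- The weights of the observations in the posterior mean at `x`. -/
def postWeight (k : X → X → ℝ) (σ : ℝ) (a : ι → X) (x : X) : ι → ℝ :=
  (noisyGram k σ a)⁻¹ *ᵥ fun i => k (a i) x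

theorem postMean_eq {k : X → X → ℝ} (hk : (Matrix.of k).PosSemidef) (m : X → ℝ) (σ : ℝ)
    (a : ι → X) (y : ι → ℝ) (x : X) :
    postMean m k σ a y x = m x + ∑ i, postWeight k σ a x i * (y i - m (a i)) := by
  rw [postMean, Matrix.dotProduct_mulVec, ← Matrix.mulVec_transpose, Matrix.transpose_nonsing_inv,
    noisyGram_transpose hk]
  rfl

theorem postKernel_eq (k : X → X → ℝ) (σ : ℝ) (a : ι → X) (x x' : X) :
    postKernel k σ a x x' = k x x' - ∑ i, k (a i) x * postWeight k σ a x' i := rfl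

theorem postKernel_comp (k : X → X → ℝ) (σ : ℝ) (a : ι → X) (e : κ ≃ ι) (x x' : X) :
    postKernel k σ (a ∘ e) x x' = postKernel k σ a x x' := by
  rw [postKernel, postKernel, noisyGram_comp, Matrix.inv_submatrix_equiv,
    Matrix.submatrix_mulVec_equiv]
  congr 1
  simp only [dotProduct, Function.comp_apply]
  rw [← e.sum_comp]
  congr 2
  ext i
  congr 3
  ext j
  simp

theorem postMean_comp (m : X → ℝ) (k : X → X → ℝ) (σ : ℝ) (a : ι → X) (y : ι → ℝ) (e : κ ≃ ι)
    (x : X) : postMean m k σ (a ∘ e) (y ∘ e) x = postMean m k σ a y x := by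
  rw [postMean, postMean, noisyGram_comp, Matrix.inv_submatrix_equiv,
    Matrix.submatrix_mulVec_equiv]
  congr 1
  simp only [dotProduct, Function.comp_apply]
  rw [← e.sum_comp]
  congr 2
  ext i
  congr 3
  ext j
  simp

variable [Finite X] {k : X → X → ℝ} (hk : (Matrix.of k).PosSemidef) {σ : ℝ}
    (hσ : 0 < σ)

include hk hσ

theorem noisyGram_mulVec_postWeight (a : ι → X) (x : X) :
    noisyGram k σ a *ᵥ postWeight k σ a x = fun i => k (a i) x := by
  rw [postWeight, Matrix.mulVec_mulVec, Matrix.mul_nonsing_inv _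
    ((Matrix.isUnit_iff_isUnit_det _).1 (posDef_noisyGram hk hσ a).isUnit), Matrix.one_mulVec]

theorem postWeight_unique (a : ι → X) (x : X) (w : ι → ℝ)
    (hw : noisyGram k σ a *ᵥ w = fun i => k (a i) x) : postWeight k σ a x = w := by
  rw [postWeight, ← hw, Matrix.mulVec_mulVec, Matrix.nonsing_inv_mul _
    ((Matrix.isUnit_iff_isUnit_det _).1 (posDef_noisyGram hk hσ a).isUnit), Matrix.one_mulVec]

/-- The posterior kernel is the Schur complement of `K + σ² I` in the Gram matrix of the observed
locations followed by all arms, with `σ²` added on the diagonal of the first block. -/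
theorem postKernel_posSemidef (a : ι → X) : (Matrix.of (postKernel k σ a)).PosSemidef := by
  classical
  have hA := posDef_noisyGram hk hσ a
  have := hA.isUnit.invertible
  let B : Matrix ι X ℝ := Matrix.of fun i x => k (a i) x
  have h0 : (Matrix.fromBlocks (σ ^ 2 • (1 : Matrix ι ι ℝ)) 0 0
      (0 : Matrix X X ℝ)).PosSemidef := by
    have h : Matrix.fromBlocks (σ ^ 2 • (1 : Matrix ι ι ℝ)) 0 0 (0 : Matrix X X ℝ) =
        Matrix.diagonal (Sum.elim (fun _ => σ ^ 2) fun _ => 0) := by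
      rw [← Matrix.diagonal_zero, ← Matrix.diagonal_one, ← Matrix.diagonal_smul,
        Matrix.fromBlocks_diagonal]
      congr 1
      ext (i | i) <;> simp
    rw [h]
    exact Matrix.PosSemidef.diagonal fun i => by rcases i with i | i <;> simp [sq_nonneg]
  have h1 : (Matrix.fromBlocks (noisyGram k σ a) B Bᴴ (Matrix.of k)).PosSemidef := by
    have h : Matrix.fromBlocks (noisyGram k σ a) B Bᴴ (Matrix.of k) =
        (Matrix.of k).submatrix (Sum.elim a id) (Sum.elim a id) +
          Matrix.fromBlocks (σ ^ 2 • (1 : Matrix ι ι ℝ)) 0 0 (0 : Matrix X X ℝ) := by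
      ext (i | i) (j | j)
      · simp [noisyGram]
      · simp [B]
      · simp [B, kernel_symm hk i]
      · simp
    rw [h]
    exact (hk.submatrix _).add h0
  have h2 := (Matrix.PosDef.fromBlocks₁₁ B (Matrix.of k) hA).1 h1
  convert! h2 using 1
  ext x x'
  rw [Matrix.mul_assoc]
  simp [postKernel, B, Matrix.mul_apply, dotProduct, Matrix.mulVec]

theorem postKernel_self_le (a : ι → X) (x : X) : postKernel k σ a x x ≤ k x x := by
  rw [postKernel, sub_le_self_iff]
  have h := (posDef_noisyGram hk hσ a).inv.posSemidef.dotProduct_mulVec_nonneg fun i => k (a i) x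
  simpa using h

/-- The new location `a none` receives the Kalman gain `g` as its weight, and the old weights at `x`
lose `g` times the weights that predict `a none`. Since the regularised Gram matrix is invertible,
it is enough to check the linear system; no block inverse is computed. -/
theorem postWeight_option (a : Option ι → X) (x : X) :
    postWeight k σ a x = fun o => o.elim
      (postKernel k σ (a ∘ some) (a none) x /
        (postKernel k σ (a ∘ some) (a none) (a none) + σ ^ 2))
      (fun i => postWeight k σ (a ∘ some) x i - postKernel k σ (a ∘ some) (a none) x /
        (postKernel k σ (a ∘ some) (a none) (a none) + σ ^ 2) *
        postWeight k σ (a ∘ some) (a none) i) := by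
  apply postWeight_unique hk hσ
  have hb : 0 ≤ postKernel k σ (a ∘ some) (a none) (a none) := by
    simpa using (postKernel_posSemidef hk hσ (a ∘ some)).diag_nonneg (i := a none)
  have hpos : postKernel k σ (a ∘ some) (a none) (a none) + σ ^ 2 ≠ 0 := by positivity
  set g := postKernel k σ (a ∘ some) (a none) x /
        (postKernel k σ (a ∘ some) (a none) (a none) + σ ^ 2) with hg
  have hg' : g * (postKernel k σ (a ∘ some) (a none) (a none) + σ ^ 2) =
      postKernel k σ (a ∘ some) (a none) x := div_mul_cancel₀ _ hpos
  have hw : ∀ x i, (noisyGram k σ (a ∘ some) *ᵥ postWeight k σ (a ∘ some) x) i =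
      k (a (some i)) x := fun x i => congrFun (noisyGram_mulVec_postWeight hk hσ (a ∘ some) x) i
  ext o
  rcases o with _ | i
  · rw [postKernel_eq, postKernel_eq] at hg'
    simp only [Function.comp_apply, kernel_symm hk (a (some _)) (a none)] at hg'
    simp only [noisyGram, Matrix.mulVec, dotProduct, Fintype.sum_option, Matrix.add_apply,
      Matrix.of_apply, Matrix.smul_apply, Matrix.one_apply, Option.elim, mul_sub,
      Finset.sum_sub_distrib, if_true, smul_eq_mul, reduceCtorEq, if_false, mul_zero, add_zero,
      mul_one]
    simp only [mul_left_comm _ g, ← Finset.mul_sum]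
    linear_combination hg'
  · have h1 := hw x i
    have h2 := hw (a none) i
    simp only [noisyGram, Matrix.mulVec, dotProduct, Matrix.add_apply,
      Matrix.of_apply, Matrix.smul_apply, Matrix.one_apply, Function.comp_apply] at h1 h2
    simp only [noisyGram, Matrix.mulVec, dotProduct, Fintype.sum_option, Matrix.add_apply,
      Matrix.of_apply, Matrix.smul_apply, Matrix.one_apply, Option.elim, mul_sub,
      Finset.sum_sub_distrib, reduceCtorEq, if_false, smul_zero, add_zero, Option.some_inj]
    simp only [mul_left_comm _ g, ← Finset.mul_sum]
    linear_combination h1 - g * h2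

theorem postKernel_option (a : Option ι → X) (x x' : X) :
    postKernel k σ a x x' = postKernel k σ (a ∘ some) x x' -
      postKernel k σ (a ∘ some) x (a none) /
        (postKernel k σ (a ∘ some) (a none) (a none) + σ ^ 2) *
        postKernel k σ (a ∘ some) (a none) x' := by
  have h1 := postKernel_eq k σ (a ∘ some) x x'
  have h2 := postKernel_eq k σ (a ∘ some) x (a none)
  rw [postKernel_eq, postWeight_option hk hσ, Fintype.sum_option]
  simp only [Option.elim, mul_sub, Finset.sum_sub_distrib, Function.comp_apply] at h1 h2 ⊢
  set g := postKernel k σ (a ∘ some) (a none) x' /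
        (postKernel k σ (a ∘ some) (a none) (a none) + σ ^ 2) with hg
  simp only [mul_left_comm _ g, ← Finset.mul_sum]
  have hg' : postKernel k σ (a ∘ some) x (a none) /
      (postKernel k σ (a ∘ some) (a none) (a none) + σ ^ 2) *
      postKernel k σ (a ∘ some) (a none) x' = postKernel k σ (a ∘ some) x (a none) * g := by
    rw [hg]
    ring
  rw [hg', kernel_symm hk (a none) x]
  linear_combination (-1) * h1 + g * h2

/-- With `postKernel_option`, this is the Kalman update: the mean moves by the gain times the
innovation. It makes the residual of `f` satisfy a one-step recursion. -/
theorem postMean_option (m : X → ℝ) (a : Option ι → X) (y : Option ι → ℝ) (x : X) :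
    postMean m k σ a y x = postMean m k σ (a ∘ some) (y ∘ some) x +
      postKernel k σ (a ∘ some) x (a none) /
        (postKernel k σ (a ∘ some) (a none) (a none) + σ ^ 2) *
        (y none - postMean m k σ (a ∘ some) (y ∘ some) (a none)) := by
  rw [postMean_eq hk, postMean_eq hk, postMean_eq hk, postWeight_option hk hσ, Fintype.sum_option,
    kernel_symm (postKernel_posSemidef hk hσ (a ∘ some)) x]
  simp only [Option.elim, sub_mul, Finset.sum_sub_distrib, Function.comp_apply, mul_assoc,
    ← Finset.mul_sum]
  ring

/-- The Schur complement of the old block is the scalar predictive variance of the new observation.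
-/
theorem det_noisyGram_option (a : Option ι → X) :
    (noisyGram k σ a).det = (noisyGram k σ (a ∘ some)).det *
      (postKernel k σ (a ∘ some) (a none) (a none) + σ ^ 2) := by
  have := (posDef_noisyGram hk hσ (a ∘ some)).isUnit.invertible
  rw [← Matrix.det_submatrix_equiv_self (Equiv.optionEquivSumPUnit.{0} ι).symm,
    show (noisyGram k σ a).submatrix (Equiv.optionEquivSumPUnit.{0} ι).symm
      (Equiv.optionEquivSumPUnit.{0} ι).symm = Matrix.fromBlocks (noisyGram k σ (a ∘ some))
        (Matrix.of fun i _ => k (a (some i)) (a none))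
        (Matrix.of fun _ i => k (a none) (a (some i)))
        (Matrix.of fun _ _ => k (a none) (a none) + σ ^ 2) by
      ext (i | i) (j | j) <;> simp [noisyGram, Matrix.one_apply],
    Matrix.det_fromBlocks₁₁, Matrix.det_unique (n := Unit),
    Matrix.invOf_eq_nonsing_inv, Matrix.mul_assoc]
  simp only [postKernel, Matrix.sub_apply, Matrix.of_apply, Matrix.mul_apply, dotProduct,
    Matrix.mulVec, Function.comp_apply, kernel_symm hk (a none) (a (some _))]
  ring

end Posterior


/-! ### Differential entropy of Gaussian vectors -/

section Entropy

variable {n : ℕ}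

/-- The standard Gaussian law on `ℝⁿ`. -/
def stdNormal (n : ℕ) : Measure (Fin n → ℝ) := Measure.pi fun _ => gaussianReal 0 1

instance : IsProbabilityMeasure (stdNormal n) := by
  unfold stdNormal
  infer_instance

theorem stdNormal_eq_withDensity : stdNormal n =
    volume.withDensity fun z => ENNReal.ofReal (∏ i, gaussianPDFReal 0 1 (z i)) := by
  apply Measure.pi_eq
  intro s hs
  have hint : ∀ i, Integrable (gaussianPDFReal 0 1) (volume.restrict (s i)) := fun i =>
    (integrable_gaussianPDFReal 0 1).restrict
  rw [withDensity_apply _ (MeasurableSet.univ_pi hs), volume_pi, Measure.restrict_pi_pi,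
    ← ofReal_integral_eq_lintegral_ofReal
      (Integrable.fintype_prod_dep (f := fun _ => gaussianPDFReal 0 1) hint)
      (Filter.Eventually.of_forall fun z => Finset.prod_nonneg fun i _ =>
        gaussianPDFReal_nonneg _ _ _),
    integral_fintype_prod_eq_prod (f := fun _ => gaussianPDFReal 0 1),
    ENNReal.ofReal_prod_of_nonneg fun i _ => integral_nonneg fun z => gaussianPDFReal_nonneg _ _ _]
  exact Finset.prod_congr rfl fun i _ =>
    (gaussianReal_apply_eq_integral 0 one_ne_zero (s i)).symm

theorem stdNormal_absolutelyContinuous : stdNormal n ≪ volume := by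
  rw [stdNormal_eq_withDensity]
  exact withDensity_absolutelyContinuous _ _

theorem integrable_negMulLog_rnDeriv_stdNormal :
    Integrable (fun z => Real.negMulLog (((stdNormal n).rnDeriv volume z).toReal)) := by
  have hm : Measurable fun z : Fin n → ℝ => ∏ i, gaussianPDFReal 0 1 (z i) :=
    Finset.measurable_fun_prod _ fun i _ =>
      (measurable_gaussianPDFReal 0 1).comp (measurable_pi_apply i)
  have hpos : ∀ z : Fin n → ℝ, 0 < ∏ i, gaussianPDFReal 0 1 (z i) := fun z =>
    Finset.prod_pos fun i _ => gaussianPDFReal_pos _ _ _ one_ne_zero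
  have h1 : (stdNormal n).rnDeriv volume =ᵐ[volume]
      fun z => ENNReal.ofReal (∏ i, gaussianPDFReal 0 1 (z i)) := by
    rw [stdNormal_eq_withDensity]
    exact Measure.rnDeriv_withDensity _ hm.ennreal_ofReal
  have hlog : ∀ x : ℝ, Real.log (gaussianPDFReal 0 1 x) =
      Real.log (√(2 * Real.pi * (1 : NNReal)))⁻¹ + -(x ^ 2) / 2 := by
    intro x
    rw [gaussianPDFReal, Real.log_mul (by positivity) (Real.exp_ne_zero _), Real.log_exp]
    simp
  have hcoord : Integrable (fun x : ℝ => Real.log (gaussianPDFReal 0 1 x)) (gaussianReal 0 1) := by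
    simp_rw [hlog]
    have h2 : Integrable (fun x : ℝ => x ^ 2) (gaussianReal 0 1) :=
      (memLp_id_gaussianReal' (μ := 0) (v := 1) 2 (by simp)).integrable_sq
    exact (integrable_const _).add (h2.neg.div_const 2)
  have hsum : Integrable (fun z : Fin n → ℝ => ∑ i, -Real.log (gaussianPDFReal 0 1 (z i)))
      (stdNormal n) :=
    integrable_finsetSum _ fun i _ =>
      ((measurePreserving_eval (fun _ : Fin n => gaussianReal 0 1) i).integrable_comp_of_integrable
        hcoord).neg
  rw [stdNormal_eq_withDensity, integrable_withDensity_iff_integrable_smul'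
    hm.ennreal_ofReal (by simp)] at hsum
  refine hsum.congr ?_
  filter_upwards [h1] with z hz
  rw [hz, ENNReal.toReal_ofReal (hpos z).le, Real.negMulLog,
    Real.log_prod fun i _ => (gaussianPDFReal_pos _ _ _ one_ne_zero).ne']
  simp [Finset.sum_neg_distrib]

/-- Differential entropy under an invertible affine change of variables. -/
theorem diffEntropy_map_affine (ν : Measure (Fin n → ℝ)) [IsProbabilityMeasure ν]
    (hν : ν ≪ volume) (hint : Integrable fun z => Real.negMulLog ((ν.rnDeriv volume z).toReal))
    (c : Fin n → ℝ) (M : Matrix (Fin n) (Fin n) ℝ) (hM : M.det ≠ 0) :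
    diffEntropy (ν.map fun z => c + M *ᵥ z) = diffEntropy ν + Real.log |M.det| := by
  set D := |M.det| with hD
  have hDpos : 0 < D := abs_pos.2 hM
  let e : (Fin n → ℝ) ≃ₗ[ℝ] (Fin n → ℝ) := Matrix.toLin'OfInv
    (M := M⁻¹) (M' := M) (Matrix.nonsing_inv_mul _ (isUnit_iff_ne_zero.2 hM))
    (Matrix.mul_nonsing_inv _ (isUnit_iff_ne_zero.2 hM))
  have hemb : MeasurableEmbedding fun z : Fin n → ℝ => c + M *ᵥ z := by
    have h := ((e.toContinuousLinearEquiv.toHomeomorph).trans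
      (Homeomorph.addLeft c)).measurableEmbedding
    convert! h using 1
  have hvol : (volume : Measure (Fin n → ℝ)).map (fun z => c + M *ᵥ z) =
      ENNReal.ofReal D⁻¹ • volume := by
    have h := Real.map_matrix_volume_pi_eq_smul_volume_pi hM
    have h2 : (fun z : Fin n → ℝ => c + M *ᵥ z) = (fun z => c + z) ∘ (Matrix.toLin' M) := rfl
    rw [h2, ← Measure.map_map (by fun_prop) (LinearMap.continuous_of_finiteDimensional _).measurable,
      h, Measure.map_smul,
      map_add_left_eq_self, abs_inv]
  have hD0 : ENNReal.ofReal D⁻¹ ≠ 0 := by simpa using hDpos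
  have h1 : ∀ᵐ z, ((ν.map fun z => c + M *ᵥ z).rnDeriv volume (c + M *ᵥ z)).toReal =
      D⁻¹ * (ν.rnDeriv volume z).toReal := by
    have h3 := hemb.rnDeriv_map ν volume
    have h4 := Measure.rnDeriv_smul_right_of_ne_top (ν.map fun z => c + M *ᵥ z)
      (volume : Measure (Fin n → ℝ)) hD0 ENNReal.ofReal_ne_top
    -- The scaled volume is the image of `volume` under the affine map, so an almost everywhere
    -- statement for it can be pulled back to `z`.
    replace h4 : ∀ᵐ y ∂(ENNReal.ofReal D⁻¹ • (volume : Measure (Fin n → ℝ))),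
        (ν.map fun z => c + M *ᵥ z).rnDeriv (ENNReal.ofReal D⁻¹ • volume) y =
          ((ENNReal.ofReal D⁻¹)⁻¹ • (ν.map fun z => c + M *ᵥ z).rnDeriv volume) y :=
      Measure.ae_smul_measure h4 _
    rw [← hvol, hemb.ae_map_iff] at h4
    filter_upwards [h3, h4] with z hz hz'
    rw [hz, Pi.smul_apply, smul_eq_mul] at hz'
    rw [hz', ENNReal.toReal_mul, ENNReal.toReal_inv, ENNReal.toReal_ofReal (by positivity),
      inv_inv, inv_mul_cancel_left₀ hDpos.ne']
  have hone : ∫ z, (ν.rnDeriv volume z).toReal = 1 := by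
    rw [Measure.integral_toReal_rnDeriv hν]
    simp
  have h2 : ∀ g : (Fin n → ℝ) → ℝ, ∫ y, g y = D * ∫ z, g (c + M *ᵥ z) := by
    intro g
    rw [← hemb.integral_map, hvol, integral_smul_measure, ENNReal.toReal_ofReal (by positivity),
      smul_eq_mul, mul_inv_cancel_left₀ hDpos.ne']
  rw [diffEntropy, h2, integral_congr_ae (h1.mono fun z hz => congrArg Real.negMulLog hz)]
  -- The product rule separates a multiple of the total mass, which produces `log D`, from the
  -- entropy of `ν`; integrability of each summand permits the splitting.
  simp_rw [Real.negMulLog_mul]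
  rw [integral_add (Measure.integrable_toReal_rnDeriv.mul_const _) (hint.const_mul _),
    integral_mul_const, hone, integral_const_mul, diffEntropy]
  rw [Real.negMulLog, Real.log_inv]
  field_simp
  ring

theorem diffEntropy_map_stdNormal (c : Fin n → ℝ) (M : Matrix (Fin n) (Fin n) ℝ)
    (hM : M.det ≠ 0) : diffEntropy ((stdNormal n).map fun z => c + M *ᵥ z) =
      diffEntropy (stdNormal n) + Real.log |M.det| :=
  diffEntropy_map_affine _ stdNormal_absolutelyContinuous integrable_negMulLog_rnDeriv_stdNormal
    c M hM

open scoped MatrixOrder in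
-- `M` is the positive square root of the covariance; the entropy computation needs only its
-- determinant.
theorem gpLaw_eq_map_stdNormal (m : Fin n → ℝ) {k : Fin n → Fin n → ℝ}
    (hk : (Matrix.of k).PosSemidef) : ∃ M : Matrix (Fin n) (Fin n) ℝ, M.det ^ 2 = (Matrix.of k).det ∧
      gpLaw m k = (stdNormal n).map fun z => m + M *ᵥ z := by
  refine ⟨CFC.sqrt (Matrix.of k), ?_, ?_⟩
  · rw [sq, ← Matrix.det_mul, CFC.sqrt_mul_sqrt_self _ hk.nonneg]
  · rw [gpLaw, multivariateGaussian, ← map_pi_eq_stdGaussian,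
      Measure.map_map (by fun_prop) (by fun_prop), Measure.map_map (by fun_prop) (by fun_prop)]
    rfl

theorem noiseLaw_eq_map (σ : ℝ) (n : ℕ) :
    noiseLaw σ n = (stdNormal n).map fun z i => σ * z i := by
  rw [stdNormal, Measure.pi_map_pi (f := fun _ z => σ * z) fun _ => by fun_prop]
  rw [noiseLaw]
  congr 1
  ext i : 1
  rw [gaussianReal_map_const_mul, mul_zero, mul_one]
  congr 1
  apply NNReal.coe_injective
  simp [sq_nonneg]

end Entropy

/-! ### Information gain as a log-determinant -/

section InfoGain

variable {X : Type*} [Fintype X] [DecidableEq X]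

omit [Fintype X] [DecidableEq X] in
-- Fixing `f` only translates the noise, so the value does not depend on `f` and the average over
-- `f` in `infoGain` is trivial.
theorem diffEntropy_obsLawGiven (f : X → ℝ) {σ : ℝ} (hσ : 0 < σ) {n : ℕ} (a : Fin n → X) :
    diffEntropy (obsLawGiven f σ a) = diffEntropy (stdNormal n) + n * Real.log σ := by
  have hdet : (σ • (1 : Matrix (Fin n) (Fin n) ℝ)).det = σ ^ n := by simp
  have h := diffEntropy_map_stdNormal (fun i => f (a i)) (σ • (1 : Matrix (Fin n) (Fin n) ℝ))
    (by rw [hdet]; positivity)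
  rw [hdet, abs_of_pos (by positivity), Real.log_pow] at h
  rw [← h, obsLawGiven, noiseLaw_eq_map, Measure.map_map (by fun_prop) (by fun_prop)]
  congr 2
  ext z i
  simp [Matrix.smul_mulVec]

theorem obsLaw_eq_gpLaw (m : X → ℝ) {k : X → X → ℝ} (hk : (Matrix.of k).PosSemidef) {σ : ℝ}
    (hσ : 0 < σ) {n : ℕ} (a : Fin n → X) :
    obsLaw m k σ a = gpLaw (fun i => m (a i)) (noisyGram k σ a) := by
  have hN : IsGaussian (noiseLaw σ n) := by
    have h := (iIndepFun_pi (μ := fun _ : Fin n => gaussianReal 0 (σ ^ 2).toNNReal)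
      (X := fun _ x => x) fun _ => aemeasurable_id).hasGaussianLaw fun i =>
        (HasLaw.mk (measurable_pi_apply i).aemeasurable (measurePreserving_eval
          (fun _ : Fin n => gaussianReal 0 (σ ^ 2).toNNReal) i).map_eq).hasGaussianLaw
    simpa [noiseLaw] using h.isGaussian_map
  set Q := (gpLaw m k).prod (noiseLaw σ n) with hQ
  have m1 : ∀ x, MemLp (fun q : (X → ℝ) × (Fin n → ℝ) => q.1 x) 2 Q := fun x =>
    (memLp_eval_of_isGaussian (gpLaw m k) x).comp_measurePreserving measurePreserving_fst
  have m2 : ∀ i, MemLp (fun q : (X → ℝ) × (Fin n → ℝ) => q.2 i) 2 Q := fun i =>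
    (memLp_eval_of_isGaussian (noiseLaw σ n) i).comp_measurePreserving measurePreserving_snd
  have mp : ∀ i, MeasurePreserving (fun e : Fin n → ℝ => e i) (noiseLaw σ n)
      (gaussianReal 0 (σ ^ 2).toNNReal) := measurePreserving_eval _
  have mp' : ∀ i, MeasurePreserving (fun q : (X → ℝ) × (Fin n → ℝ) => q.2 i)
      ((gpLaw m k).prod (noiseLaw σ n)) (gaussianReal 0 (σ ^ 2).toNNReal) := fun i =>
    (mp i).comp measurePreserving_snd
  have i1 : ∀ x, ∫ q, q.1 x ∂Q = m x := fun x => by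
    have h := integral_map (μ := Q) (φ := Prod.fst) (f := fun r : X → ℝ => r x)
      (by fun_prop) (aestronglyMeasurable_eval _ x)
    rw [hQ, measurePreserving_fst.map_eq, integral_eval_gpLaw] at h
    exact h.symm
  have i2 : ∀ i, ∫ q, q.2 i ∂Q = 0 := fun i => by
    have h := integral_map (μ := Q) (φ := fun q => q.2 i) (f := fun r : ℝ => r)
      (by fun_prop) (by fun_prop)
    rw [hQ, (mp' i).map_eq, integral_id_gaussianReal] at h
    exact h.symm
  have c11 : ∀ x x', cov[fun q => q.1 x, fun q => q.1 x'; Q] = k x x' := by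
    intro x x'
    have h := covariance_map (μ := Q) (Z := Prod.fst) (X := fun r : X → ℝ => r x)
      (Y := fun r : X → ℝ => r x') (aestronglyMeasurable_eval _ x)
      (aestronglyMeasurable_eval _ x') (by fun_prop)
    rw [hQ, measurePreserving_fst.map_eq, covariance_eval_gpLaw m hk] at h
    exact h.symm
  have c12 : ∀ x i, cov[fun q => q.1 x, fun q => q.2 i; Q] = 0 := fun x i =>
    IndepFun.covariance_eq_zero (indepFun_prod (X := fun r : X → ℝ => r x)
      (Y := fun e : Fin n → ℝ => e i) (by fun_prop) (by fun_prop)) (m1 x) (m2 i)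
  have c22 : ∀ i j, cov[fun q => q.2 i, fun q => q.2 j; Q] = if i = j then σ ^ 2 else 0 := by
    intro i j
    split_ifs with hij
    · subst hij
      have h := covariance_map (μ := Q) (Z := fun q => q.2 i) (X := fun r : ℝ => r)
        (Y := fun r : ℝ => r) (by fun_prop) (by fun_prop) (by fun_prop)
      rw [hQ, (mp' i).map_eq, covariance_self (by fun_prop),
        variance_fun_id_gaussianReal, Real.coe_toNNReal _ (sq_nonneg _)] at h
      exact h.symm
    · have h := covariance_map (μ := Q) (Z := Prod.snd) (X := fun r : Fin n → ℝ => r i)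
        (Y := fun r : Fin n → ℝ => r j) (aestronglyMeasurable_eval _ i)
        (aestronglyMeasurable_eval _ j) (by fun_prop)
      rw [hQ, measurePreserving_snd.map_eq] at h
      refine h.symm.trans (IndepFun.covariance_eq_zero ?_ (memLp_eval_of_isGaussian _ i)
        (memLp_eval_of_isGaussian _ j))
      exact (iIndepFun_pi (μ := fun _ : Fin n => gaussianReal 0 (σ ^ 2).toNNReal)
        (X := fun _ x => x) fun _ => aemeasurable_id).indepFun hij
  let L : ((X → ℝ) × (Fin n → ℝ)) →L[ℝ] (Fin n → ℝ) :=
    ContinuousLinearMap.pi fun i => (ContinuousLinearMap.proj (a i)).comp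
      (ContinuousLinearMap.fst ℝ (X → ℝ) (Fin n → ℝ)) + (ContinuousLinearMap.proj i).comp
      (ContinuousLinearMap.snd ℝ (X → ℝ) (Fin n → ℝ))
  have hL : obsLaw m k σ a = Q.map L := rfl
  have hmeas : Measurable fun q : (X → ℝ) × (Fin n → ℝ) => L q := L.continuous.measurable
  rw [hL]
  apply eq_gpLaw_of_isGaussian _ _ (posDef_noisyGram hk hσ a).posSemidef
  · intro i
    rw [integral_map hmeas.aemeasurable (aestronglyMeasurable_eval _ i)]
    exact (integral_add ((m1 (a i)).integrable (by norm_num))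
      ((m2 i).integrable (by norm_num))).trans (by rw [i1, i2, add_zero])
  · intro i j
    rw [covariance_map (aestronglyMeasurable_eval _ i) (aestronglyMeasurable_eval _ j)
      hmeas.aemeasurable]
    change cov[(fun q => q.1 (a i)) + fun q => q.2 i, (fun q => q.1 (a j)) + fun q => q.2 j; Q] = _
    rw [covariance_add_left (m1 _) (m2 _) ((m1 _).add (m2 _)),
      covariance_add_right (m1 _) (m1 _) (m2 _), covariance_add_right (m2 _) (m1 _) (m2 _),
      c11, c12, covariance_comm, c12, c22]
    simp [Matrix.one_apply]

/-- Both entropies are that of the standard normal plus a log-determinant. The standard normal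
entropy cancels and never has to be evaluated. -/
theorem infoGain_eq (m : X → ℝ) {k : X → X → ℝ} (hk : (Matrix.of k).PosSemidef) {σ : ℝ}
    (hσ : 0 < σ) {n : ℕ} (a : Fin n → X) :
    infoGain m k σ a = Real.log (noisyGram k σ a).det / 2 - n * Real.log σ := by
  have hG := posDef_noisyGram hk hσ a
  obtain ⟨M, hM, hlaw⟩ := gpLaw_eq_map_stdNormal (fun i => m (a i)) (k := noisyGram k σ a)
    hG.posSemidef
  have hdet : M.det ≠ 0 := by
    intro h0
    have := hG.det_pos
    rw [h0, show Matrix.of (noisyGram k σ a) = noisyGram k σ a from rfl] at hM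
    exact this.ne (by simpa using hM)
  have hlog : Real.log (noisyGram k σ a).det = 2 * Real.log |M.det| := by
    rw [Real.log_abs, show (noisyGram k σ a).det = M.det ^ 2 from hM.symm, Real.log_pow]
    norm_num
  rw [infoGain, obsLaw_eq_gpLaw m hk hσ a, hlaw, diffEntropy_map_stdNormal _ _ hdet]
  simp_rw [diffEntropy_obsLawGiven _ hσ a]
  rw [integral_const, hlog]
  simp

/-! ### Posterior variances and the information gain -/

/-- The rounds `1, …, t` are the rounds `1, …, t - 1` and `t`. -/
def icoSuccEquiv (t : ℕ) (ht : 1 ≤ t) : Option (Finset.Ico 1 t) ≃ Finset.Ico 1 (t + 1) where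
  toFun o := o.elim ⟨t, by simp [ht]⟩ fun i =>
    ⟨i, by have := Finset.mem_Ico.1 i.2; exact Finset.mem_Ico.2 (by omega)⟩
  invFun j := if h : (j : ℕ) = t then none else some ⟨j, by
    have := Finset.mem_Ico.1 j.2
    exact Finset.mem_Ico.2 (by omega)⟩
  left_inv o := by
    rcases o with _ | ⟨i, hi⟩
    · simp
    · have : i ≠ t := by simp at hi; omega
      simp [this]
  right_inv j := by
    by_cases h : (j : ℕ) = t
    · ext; simp [h]
    · simp [h]

omit [DecidableEq X] in
-- The chain rule for information: each round contributes the factor `σ² + σ_t² = σ² (1 + σ_t²/σ²)`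
-- to the determinant.
theorem log_det_noisyGram {k : X → X → ℝ} (hk : (Matrix.of k).PosSemidef) {σ : ℝ}
    (hσ : 0 < σ) (a : ℕ → X) (T : ℕ) :
    Real.log (noisyGram k σ fun i : Finset.Ico 1 (T + 1) => a i).det =
      2 * T * Real.log σ + ∑ t ∈ Finset.Icc 1 T, Real.log (1 + (σ ^ 2)⁻¹ *
        postKernel k σ (fun i : Finset.Ico 1 t => a i) (a t) (a t)) := by
  induction T with
  | zero =>
    have : IsEmpty (Finset.Ico 1 (0 + 1)) :=
      ⟨fun i => by have := Finset.mem_Ico.1 i.2; omega⟩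
    simp [Matrix.det_isEmpty]
  | succ T ih =>
    have hv : 0 ≤ postKernel k σ (fun i : Finset.Ico 1 (T + 1) => a i) (a (T + 1)) (a (T + 1)) := by
      simpa using (postKernel_posSemidef hk hσ fun i : Finset.Ico 1 (T + 1) => a i).diag_nonneg
        (i := a (T + 1))
    have hdet := (posDef_noisyGram hk hσ fun i : Finset.Ico 1 (T + 1) => a i).det_pos
    have h := det_noisyGram_option hk hσ
      ((fun i : Finset.Ico 1 (T + 1 + 1) => a i) ∘ icoSuccEquiv (T + 1) (by omega))
    rw [noisyGram_comp, Matrix.det_submatrix_equiv_self] at h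
    change _ = (noisyGram k σ fun i : Finset.Ico 1 (T + 1) => a i).det *
      (postKernel k σ (fun i : Finset.Ico 1 (T + 1) => a i) (a (T + 1)) (a (T + 1)) + σ ^ 2) at h
    rw [h, Finset.sum_Icc_succ_top (by omega), ← add_assoc, Real.log_mul hdet.ne' (by positivity), ih,
      show postKernel k σ (fun i : Finset.Ico 1 (T + 1) => a i) (a (T + 1)) (a (T + 1)) + σ ^ 2 =
        σ ^ 2 * (1 + (σ ^ 2)⁻¹ *
          postKernel k σ (fun i : Finset.Ico 1 (T + 1) => a i) (a (T + 1)) (a (T + 1))) by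
        field_simp
        ring, Real.log_mul (by positivity) (by positivity), Real.log_pow]
    push_cast
    ring

/-- Bernoulli's inequality `(1 + s)^v ≤ 1 + s v` in logarithmic form. The normalisation `k x x ≤ 1`
enters as `v ≤ 1`. -/
theorem mul_log_one_add_le {s v : ℝ} (hs : 0 ≤ s) (hv0 : 0 ≤ v) (hv1 : v ≤ 1) :
    v * Real.log (1 + s) ≤ Real.log (1 + s * v) := by
  rw [← Real.log_rpow (by positivity)]
  apply Real.log_le_log (by positivity)
  rw [mul_comm s]
  exact rpow_one_add_le_one_add_mul_self (by linarith) hv0 hv1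

/-- The posterior variances of the queried arms sum up to at most `C γ_T`. -/
theorem sum_postKernel_le (m : X → ℝ) {k : X → X → ℝ} (hk : (Matrix.of k).PosSemidef)
    (hk1 : ∀ x, k x x ≤ 1) {σ : ℝ} (hσ : 0 < σ) (a : ℕ → X) (T : ℕ) :
    ∑ t ∈ Finset.Icc 1 T, postKernel k σ (fun i : Finset.Ico 1 t => a i) (a t) (a t) ≤
      2 / Real.log (1 + (σ ^ 2)⁻¹) * maxInfoGain m k σ T := by
  have hL : 0 < Real.log (1 + (σ ^ 2)⁻¹) := Real.log_pos (by simp; positivity)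
  have hcard : Fintype.card (Finset.Ico 1 (T + 1)) = T := by simp
  let e : Fin T ≃ Finset.Ico 1 (T + 1) := (Fintype.equivFinOfCardEq hcard).symm
  have h1 : infoGain m k σ (fun i : Fin T => a (e i)) ≤ maxInfoGain m k σ T :=
    le_ciSup (f := fun A : (Σ n : Fin (T + 1), (Fin n → X)) => infoGain m k σ A.2)
      (Set.finite_range _).bddAbove ⟨Fin.last T, fun i : Fin T => a (e i)⟩
  rw [infoGain_eq m hk hσ, show (fun i : Fin T => a (e i)) =
    (fun i : Finset.Ico 1 (T + 1) => a i) ∘ e from rfl, noisyGram_comp,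
    Matrix.det_submatrix_equiv_self, log_det_noisyGram hk hσ] at h1
  have h2 : ∑ t ∈ Finset.Icc 1 T, postKernel k σ (fun i : Finset.Ico 1 t => a i) (a t) (a t) *
      Real.log (1 + (σ ^ 2)⁻¹) ≤ ∑ t ∈ Finset.Icc 1 T, Real.log (1 + (σ ^ 2)⁻¹ *
        postKernel k σ (fun i : Finset.Ico 1 t => a i) (a t) (a t)) := by
    refine Finset.sum_le_sum fun t _ => mul_log_one_add_le (by positivity) ?_
      ((postKernel_self_le hk hσ _ _).trans (hk1 _))
    simpa using (postKernel_posSemidef hk hσ fun i : Finset.Ico 1 t => a i).diag_nonneg (i := a t)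
  rw [← Finset.sum_mul] at h2
  rw [div_mul_eq_mul_div, le_div_iff₀ hL]
  linarith

end InfoGain


/-! ### Conditional laws -/

section ConditionalLaws

variable {Ω S : Type*} [MeasurableSpace S]

/-- Two finite measures agree on the σ-algebra generated by `m` and `m'` if they agree on the
intersections of a set of `m` with a set of `m'`. -/
theorem measure_eq_of_eq_inter {m m' mΩ : MeasurableSpace Ω} (hm : m ≤ mΩ) (hm' : m' ≤ mΩ)
    (ν₁ ν₂ : Measure Ω) [IsFiniteMeasure ν₁]
    (h : ∀ E B, MeasurableSet[m] E → MeasurableSet[m'] B → ν₁ (E ∩ B) = ν₂ (E ∩ B))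
    {s : Set Ω} (hs : MeasurableSet[m ⊔ m'] s) : ν₁ s = ν₂ s := by
  have huniv : ν₁ Set.univ = ν₂ Set.univ := by
    simpa using h Set.univ Set.univ MeasurableSet.univ MeasurableSet.univ
  have : IsFiniteMeasure ν₂ := ⟨by rw [← huniv]; exact measure_lt_top _ _⟩
  have hsup : m ⊔ m' ≤ mΩ := sup_le hm hm'
  have hgen : m ⊔ m' = MeasurableSpace.generateFrom
      {s | ∃ E B, MeasurableSet[m] E ∧ MeasurableSet[m'] B ∧ E ∩ B = s} := by
    apply le_antisymm
    · apply sup_le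
      · intro E hE
        exact MeasurableSpace.measurableSet_generateFrom
          ⟨E, Set.univ, hE, MeasurableSet.univ, Set.inter_univ E⟩
      · intro B hB
        exact MeasurableSpace.measurableSet_generateFrom
          ⟨Set.univ, B, MeasurableSet.univ, hB, Set.univ_inter B⟩
    · apply MeasurableSpace.generateFrom_le
      rintro _ ⟨E, B, hE, hB, rfl⟩
      exact MeasurableSet.inter (le_sup_left (a := m) _ hE) (le_sup_right (b := m') _ hB)
  have hpi : IsPiSystem {s | ∃ E B, MeasurableSet[m] E ∧ MeasurableSet[m'] B ∧ E ∩ B = s} := by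
    rintro _ ⟨E, B, hE, hB, rfl⟩ _ ⟨E', B', hE', hB', rfl⟩ _
    exact ⟨E ∩ E', B ∩ B', hE.inter hE', hB.inter hB', Set.inter_inter_inter_comm _ _ _ _⟩
  induction s, hs using MeasurableSpace.induction_on_inter hgen hpi with
  | empty => simp
  | basic s hs =>
    obtain ⟨E, B, hE, hB, rfl⟩ := hs
    exact h E B hE hB
  | compl s hs ih =>
    rw [measure_compl (hsup _ hs) (measure_ne_top _ _), measure_compl (hsup _ hs)
      (measure_ne_top _ _), ih, huniv]
  | iUnion f hd hf ih =>
    rw [measure_iUnion hd fun i => hsup _ (hf i), measure_iUnion hd fun i => hsup _ (hf i)]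
    simp_rw [ih]

/-- If, on `A`, the event `D` has constant conditional probability `c` given `m`, and if the
events of `m'` are conditionally independent of a σ-algebra `n` containing `D` given `m`, then `D`
still has conditional probability `c` on `A` given `m` and `m'`. -/
theorem measure_inter_eq_of_condIndep {m m' n mΩ : MeasurableSpace Ω} (hmn : m ≤ n) (hn : n ≤ mΩ)
    (hm' : m' ≤ mΩ) (Pr : Measure Ω) [IsProbabilityMeasure Pr]
    (hg : ∀ B, MeasurableSet[m'] B → ∃ g : Ω → ℝ, StronglyMeasurable[m] g ∧ Pr⟦B | n⟧ =ᵐ[Pr] g)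
    {A D : Set Ω} (hA : MeasurableSet[m] A) (hD : MeasurableSet[n] D) {c : ENNReal} (hc : c ≠ ⊤)
    (h : ∀ E, MeasurableSet[m] E → Pr (E ∩ (A ∩ D)) = c * Pr (E ∩ A)) :
    ∀ E, MeasurableSet[m ⊔ m'] E → Pr (E ∩ (A ∩ D)) = c * Pr (E ∩ A) := by
  have hm : m ≤ mΩ := hmn.trans hn
  have hAD : MeasurableSet[n] (A ∩ D) := (hmn _ hA).inter hD
  intro E hE
  have hEm : MeasurableSet E := sup_le hm hm' _ hE
  have key := measure_eq_of_eq_inter hm hm' (Pr.restrict (A ∩ D)) (c • Pr.restrict A) ?_ hE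
  · rw [Measure.smul_apply, Measure.restrict_apply hEm, Measure.restrict_apply hEm] at key
    exact key
  intro E B hE hB
  obtain ⟨g, hgm, hgB⟩ := hg B hB
  -- This turns probabilities of intersections with `B` into integrals of `g`. As `g` is
  -- `m`-measurable, such an integral sees only the trace of the measure on `m`, where `h` already
  -- gives proportionality.
  have hset : ∀ F, MeasurableSet[n] F → Pr.real (F ∩ B) = ∫ ω in F, g ω ∂Pr := by
    intro F hF
    rw [← setIntegral_congr_ae (hn _ hF) (hgB.mono fun ω hω _ => hω),
      setIntegral_condExp hn ((integrable_const (1 : ℝ)).indicator (hm' _ hB)) hF,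
      setIntegral_indicator (hm' _ hB)]
    simp [Measure.real]
  have htrim : (Pr.restrict (E ∩ (A ∩ D))).trim hm = (c • Pr.restrict (E ∩ A)).trim hm := by
    refine @Measure.ext _ m _ _ fun F hF => ?_
    rw [trim_measurableSet_eq hm hF, trim_measurableSet_eq hm hF, Measure.smul_apply,
      Measure.restrict_apply (hm _ hF), Measure.restrict_apply (hm _ hF),
      ← Set.inter_assoc F E A, ← Set.inter_assoc F E (A ∩ D), h _ (hF.inter hE), smul_eq_mul]
  have e1 := hset (E ∩ (A ∩ D)) ((hmn _ hE).inter hAD)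
  have e2 := hset (E ∩ A) (hmn _ (hE.inter hA))
  rw [integral_trim hm hgm, htrim, ← integral_trim hm hgm, integral_smul_measure, ← e2,
    smul_eq_mul] at e1
  rw [Measure.smul_apply, Measure.restrict_apply ((hm _ hE).inter (hm' _ hB)),
    Measure.restrict_apply ((hm _ hE).inter (hm' _ hB)), Set.inter_right_comm,
    Set.inter_right_comm E B A, smul_eq_mul]
  rw [← ENNReal.toReal_eq_toReal_iff' (measure_ne_top _ _)
    (ENNReal.mul_ne_top hc (measure_ne_top _ _)), ENNReal.toReal_mul]
  exact e1

/-- Independent noise stays independent after restriction to an event it is independent of. -/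
theorem map_restrict_prodMk_of_indep {T : Type*} [MeasurableSpace T] {n mΩ : MeasurableSpace Ω}
    (hn : n ≤ mΩ) (Pr : Measure Ω)
    [IsProbabilityMeasure Pr] {e : Ω → T} (he : Measurable e)
    (hind : Indep (MeasurableSpace.comap e inferInstance) n Pr)
    {M : Ω → S} (hM : Measurable[n] M) {E : Set Ω} (hE : MeasurableSet[n] E) :
    (Pr.restrict E).map (fun ω => (M ω, e ω)) = ((Pr.restrict E).map M).prod (Pr.map e) := by
  have hM' : Measurable M := hM.mono hn le_rfl
  have := Measure.isProbabilityMeasure_map (μ := Pr) he.aemeasurable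
  symm
  apply Measure.prod_eq
  intro s t hs ht
  rw [Measure.map_apply (hM'.prodMk he) (hs.prod ht), Measure.map_apply hM' hs,
    Measure.map_apply he ht, Measure.restrict_apply ((hM'.prodMk he) (hs.prod ht)),
    Measure.restrict_apply (hM' hs)]
  have h := (Indep_iff _ _ Pr).1 hind (e ⁻¹' t) (M ⁻¹' s ∩ E) ⟨t, ht, rfl⟩ ((hM hs).inter hE)
  rw [mul_comm, ← h]
  congr 1
  ext ω
  simp only [Set.mem_inter_iff, Set.mem_preimage, Set.mem_prod]
  tauto

/-- A variable which on `A` is conditionally Gaussian with measurable mean `M` and variance `v`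
deviates from `M` by more than `c √v` with probability at most `exp (- c² / 2)`. -/
theorem measure_inter_tail_le {mΩ : MeasurableSpace Ω} (Pr : Measure Ω)
    [IsProbabilityMeasure Pr] {A : Set Ω}
    {M Y : Ω → ℝ} (hM : Measurable M) (hY : Measurable Y) (v : NNReal)
    (h : ∀ B C, MeasurableSet B → MeasurableSet C → Pr.real (A ∩ M ⁻¹' C ∩ Y ⁻¹' B) =
      ∫ ω in A ∩ M ⁻¹' C, (gaussianReal (M ω) v).real B ∂Pr)
    {c : ℝ} (hc : 0 ≤ c) :
    Pr (A ∩ {ω | c * √v < |Y ω - M ω|}) ≤ ENNReal.ofReal (Real.exp (-c ^ 2 / 2)) * Pr A := by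
  let κ : Kernel ℝ ℝ := ⟨fun a => gaussianReal a v,
    measurable_gaussianReal.comp (measurable_id.prodMk measurable_const)⟩
  have : IsMarkovKernel κ := ⟨fun a => by
    change IsProbabilityMeasure (gaussianReal a v)
    infer_instance⟩
  -- The deviation event involves `M` and `Y` together, so the joint law is required; it is
  -- determined by rectangles.
  have hlaw : (Pr.restrict A).map (fun ω => (M ω, Y ω)) = ((Pr.restrict A).map M) ⊗ₘ κ := by
    apply Measure.ext_prod
    intro C B hC hB
    rw [Measure.map_apply (hM.prodMk hY) (hC.prod hB), Measure.restrict_apply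
      ((hM.prodMk hY) (hC.prod hB)), Measure.compProd_apply_prod hC hB,
      setLIntegral_map hC (κ.measurable_coe hB) hM, Measure.restrict_restrict (hM hC)]
    have h1 := h B C hB hC
    have h2 : ∫ ω in A ∩ M ⁻¹' C, (gaussianReal (M ω) v).real B ∂Pr =
        (∫⁻ ω in A ∩ M ⁻¹' C, κ (M ω) B ∂Pr).toReal :=
      integral_toReal ((κ.measurable_coe hB).comp hM).aemeasurable
        (Filter.Eventually.of_forall fun ω => measure_lt_top _ _)
    rw [h2] at h1
    have hfin : ∫⁻ ω in A ∩ M ⁻¹' C, κ (M ω) B ∂Pr ≠ ⊤ := by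
      refine ((lintegral_mono fun ω => prob_le_one).trans_lt ?_).ne
      simp
    rw [Measure.real, ENNReal.toReal_eq_toReal_iff' (measure_ne_top _ _) hfin] at h1
    rw [Set.inter_comm (M ⁻¹' C) A, ← h1]
    congr 1
    ext ω
    simp only [Set.mem_inter_iff, Set.mem_preimage, Set.mem_prod]
    tauto
  have hmeas : MeasurableSet {q : ℝ × ℝ | c * √v < |q.2 - q.1|} :=
    measurableSet_lt (by fun_prop) (by fun_prop)
  calc Pr (A ∩ {ω | c * √v < |Y ω - M ω|})
      = (Pr.restrict A).map (fun ω => (M ω, Y ω)) {q : ℝ × ℝ | c * √v < |q.2 - q.1|} := by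
        rw [Measure.map_apply (hM.prodMk hY) hmeas, Measure.restrict_apply
          ((hM.prodMk hY) hmeas), Set.inter_comm]
        rfl
    _ = ∫⁻ a, gaussianReal a v {y | c * √v < |y - a|} ∂((Pr.restrict A).map M) := by
        rw [hlaw, Measure.compProd_apply hmeas]
        rfl
    _ ≤ ∫⁻ _, ENNReal.ofReal (Real.exp (-c ^ 2 / 2)) ∂((Pr.restrict A).map M) :=
        lintegral_mono fun a => gaussianReal_tail a v hc
    _ = ENNReal.ofReal (Real.exp (-c ^ 2 / 2)) * Pr A := by
        rw [lintegral_const, Measure.map_apply hM MeasurableSet.univ]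
        simp

end ConditionalLaws


/-! ### Measurability with respect to the history -/

/-- Posterior quantities depend on random locations, but these take finitely many values: on each
fibre the matrices are constant. -/
theorem measurable_eval_of_finite {Ω X E : Type*} [Finite X] {m : MeasurableSpace Ω}
    [MeasurableSpace E] {F : X → Ω → E} (hF : ∀ x, Measurable (F x)) {a : Ω → X}
    (ha : ∀ x, MeasurableSet {ω | a ω = x}) : Measurable fun ω => F (a ω) ω := by
  intro s hs
  have h : (fun ω => F (a ω) ω) ⁻¹' s = ⋃ x, {ω | a ω = x} ∩ F x ⁻¹' s := by
    ext ω
    simp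
  rw [h]
  exact MeasurableSet.iUnion fun x => (ha x).inter (hF x hs)

/-- The law of independent Gaussian processes depends measurably on their means. -/
theorem measurable_pi_gpLaw {X P : Type*} [Fintype X] [DecidableEq X] [Fintype P]
    (K : P → X → X → ℝ) {B : Set (P → X → ℝ)} (hB : MeasurableSet B) :
    Measurable fun M : P → X → ℝ => (Measure.pi fun p => gpLaw (M p) (K p)).real B := by
  have h1 : ∀ (m : X → ℝ) (k : X → X → ℝ), gpLaw m k = (gpLaw 0 k).map fun r => m + r := by
    intro m k
    rw [gpLaw, gpLaw, multivariateGaussian, multivariateGaussian,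
      Measure.map_map (by fun_prop) (by fun_prop), Measure.map_map (by fun_prop) (by fun_prop),
      Measure.map_map (by fun_prop) (by fun_prop)]
    congr 1
    ext z x
    simp
  have h2 : ∀ M : P → X → ℝ, (Measure.pi fun p => gpLaw (M p) (K p)) =
      (Measure.pi fun p => gpLaw 0 (K p)).map fun z => M + z := by
    intro M
    have hM : ∀ p, IsProbabilityMeasure ((gpLaw 0 (K p)).map fun r => M p + r) := fun p => by
      rw [← h1]
      infer_instance
    have h := Measure.pi_map_pi (μ := fun p => gpLaw 0 (K p)) (f := fun p r => M p + r)
      fun p => by fun_prop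
    simp_rw [← h1] at h
    rw [← h]
    rfl
  have h3 : ∀ M : P → X → ℝ, (Measure.pi fun p => gpLaw (M p) (K p)) B =
      (Measure.pi fun p => gpLaw 0 (K p)) (Prod.mk M ⁻¹' ((fun q => q.1 + q.2) ⁻¹' B)) := by
    intro M
    rw [h2, Measure.map_apply (by fun_prop) hB]
    rfl
  simp_rw [Measure.real, h3]
  exact (measurable_measure_prodMk_left
    ((measurable_fst.add measurable_snd) hB)).ennreal_toReal

namespace Bandit

variable {Ω X P : Type*} (A : Bandit Ω X P)

/-- The arms selected in the rounds `1, …, t - 1`. -/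
def arms (t : ℕ) (ω : Ω) : Finset.Ico 1 t → X := fun i => A.arm i ω

theorem history_succ {t : ℕ} (ht : 1 ≤ t) : A.history (t + 1) = A.history t ⊔ A.sampleAlg t ⊔
    A.choiceAlg t ⊔ MeasurableSpace.comap (A.reward t) inferInstance := by
  have h : Finset.Ico 1 (t + 1) = insert t (Finset.Ico 1 t) := by
    ext i
    simp
    omega
  rw [history, h, Finset.iSup_insert, sup_comm, ← sup_assoc, ← sup_assoc]

theorem history_mono {s t : ℕ} (h : s ≤ t) : A.history s ≤ A.history t :=
  biSup_mono fun i hi => by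
    simp only [Finset.mem_Ico] at hi ⊢
    omega

theorem measurableSet_choice {t : ℕ} (U : Set (X × P)) :
    MeasurableSet[A.choiceAlg t] {ω | (A.arm t ω, A.prior t ω) ∈ U} := ⟨U, trivial, rfl⟩

theorem le_history {i t : ℕ} (hi : i ∈ Finset.Ico 1 t) :
    A.sampleAlg i ⊔ A.choiceAlg i ⊔ MeasurableSpace.comap (A.reward i) inferInstance ≤
      A.history t :=
  le_biSup (fun i => A.sampleAlg i ⊔ A.choiceAlg i ⊔
    MeasurableSpace.comap (A.reward i) inferInstance) hi

theorem measurableSet_choice_history {i t : ℕ} (hi : i ∈ Finset.Ico 1 t) (U : Set (X × P)) :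
    MeasurableSet[A.history t] {ω | (A.arm i ω, A.prior i ω) ∈ U} :=
  A.le_history hi _ ((le_sup_right.trans le_sup_left :
    A.choiceAlg i ≤ _) _ (A.measurableSet_choice U))

theorem measurable_reward_history {i t : ℕ} (hi : i ∈ Finset.Ico 1 t) :
    Measurable[A.history t] (A.reward i) :=
  (comap_measurable (A.reward i)).mono (le_sup_right.trans (A.le_history hi)) le_rfl

theorem measurableSet_arms_history (t : ℕ) (a : Finset.Ico 1 t → X) :
    MeasurableSet[A.history t] {ω | A.arms t ω = a} := by
  have h : {ω | A.arms t ω = a} = ⋂ i : Finset.Ico 1 t, {ω | A.arm i ω = a i} := by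
    ext ω
    simp [arms, funext_iff]
  rw [h]
  exact MeasurableSet.iInter fun i =>
    A.measurableSet_choice_history i.2 {q : X × P | q.1 = a i}

variable [Finite X]

theorem measurable_mean_history (μ : P → X → ℝ) (k : P → X → X → ℝ) (σ : ℝ) (t : ℕ) :
    Measurable[A.history t] fun ω p => A.mean μ k σ t p ω := by
  let _ : MeasurableSpace Ω := A.history t
  refine measurable_pi_lambda _ fun p => ?_
  have h : ∀ a : Finset.Ico 1 t → X, Measurable[A.history t] fun ω =>
      postMean (μ p) (k p) σ a fun i : Finset.Ico 1 t => A.reward i ω := by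
    intro a
    apply measurable_pi_lambda
    intro x
    simp only [postMean, dotProduct, Matrix.mulVec]
    refine measurable_const.add (Finset.measurable_fun_sum _ fun i _ => measurable_const.mul
      (Finset.measurable_fun_sum _ fun j _ => measurable_const.mul ?_))
    exact (A.measurable_reward_history j.2).sub measurable_const
  exact measurable_eval_of_finite h (A.measurableSet_arms_history t)

end Bandit

section Run

variable {Ω X P : Type*} [Fintype X] [DecidableEq X] [Fintype P] [DecidableEq P]
    [mΩ : MeasurableSpace Ω] {Pr : Measure Ω} [IsProbabilityMeasure Pr] {μ : P → X → ℝ}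
    {k : P → X → X → ℝ} {σ : ℝ} {β ξ : ℕ → ℝ} {T : ℕ} {pstar : P} {A : Bandit Ω X P}

namespace IsRun

variable (hA : IsRun Pr μ k σ β ξ T pstar A)
include hA

omit [IsProbabilityMeasure Pr] in
theorem truthAlg_le : A.truthAlg ≤ mΩ := hA.measurable_f.comap_le

omit [IsProbabilityMeasure Pr] in
theorem sampleAlg_le {t : ℕ} (ht : t ∈ Finset.Icc 1 T) : A.sampleAlg t ≤ mΩ :=
  (hA.measurable_sample t ht).comap_le

omit [IsProbabilityMeasure Pr] in
theorem choiceAlg_le {t : ℕ} (ht : t ∈ Finset.Icc 1 T) : A.choiceAlg t ≤ mΩ := by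
  rintro _ ⟨U, -, rfl⟩
  have h : (fun ω => (A.arm t ω, A.prior t ω)) ⁻¹' U =
      ⋃ q : X × P, ⋃ _ : q ∈ U, {ω | A.arm t ω = q.1 ∧ A.prior t ω = q.2} := by
    ext ω
    simp only [Set.mem_preimage, Set.mem_iUnion, Set.mem_ofPred_eq]
    constructor
    · exact fun hω => ⟨_, hω, rfl, rfl⟩
    · rintro ⟨⟨x, p⟩, hq, rfl, rfl⟩
      exact hq
  rw [h]
  exact MeasurableSet.iUnion fun q => MeasurableSet.iUnion fun _ =>
    hA.measurable_choice t ht q.1 q.2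

omit [IsProbabilityMeasure Pr] in
theorem measurable_reward {t : ℕ} (ht : t ∈ Finset.Icc 1 T) : Measurable (A.reward t) := by
  refine Measurable.add ?_ (hA.measurable_noise t ht)
  exact measurable_eval_of_finite (F := fun x ω => A.f ω x)
    (fun x => (measurable_pi_apply x).comp hA.measurable_f)
    fun x => hA.choiceAlg_le ht _ (A.measurableSet_choice {q : X × P | q.1 = x})

omit [IsProbabilityMeasure Pr] in
theorem history_le {t : ℕ} (ht : t ≤ T + 1) : A.history t ≤ mΩ := by
  refine iSup₂_le fun i hi => ?_
  have hi' : i ∈ Finset.Icc 1 T := by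
    simp only [Finset.mem_Ico, Finset.mem_Icc] at hi ⊢
    omega
  exact sup_le (sup_le (hA.sampleAlg_le hi') (hA.choiceAlg_le hi'))
    (hA.measurable_reward hi').comap_le

omit [IsProbabilityMeasure Pr] in
-- The conditional law of the samples given history and `f` is a function of the history alone. This
-- is conditional independence from `f` in the form required by `measure_inter_eq_of_condIndep`.
theorem condExp_sample {t : ℕ} (ht : t ∈ Finset.Icc 1 T) (B : Set Ω)
    (hB : MeasurableSet[A.sampleAlg t] B) : ∃ g : Ω → ℝ, StronglyMeasurable[A.history t] g ∧
      Pr⟦B | A.history t ⊔ A.truthAlg⟧ =ᵐ[Pr] g := by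
  obtain ⟨B, hB, rfl⟩ := hB
  refine ⟨_, Measurable.stronglyMeasurable ?_, hA.law_sample t ht B hB⟩
  exact measurable_eval_of_finite (F := fun (a : Finset.Ico 1 t → X) ω =>
      (Measure.pi fun p => gpLaw (A.mean μ k σ t p ω) (postKernel (k p) σ a)).real B)
    (fun a => (measurable_pi_gpLaw (fun p => postKernel (k p) σ a) hB).comp
      (A.measurable_mean_history μ k σ t))
    (A.measurableSet_arms_history t)

/-- The analogue for the selection, with the samples added to the conditioning; events in the choice
are finite disjoint unions of the single pairs treated by `tie_breaking`. -/
theorem condExp_choice {t : ℕ} (ht : t ∈ Finset.Icc 1 T) (B : Set Ω)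
    (hB : MeasurableSet[A.choiceAlg t] B) :
    ∃ g : Ω → ℝ, StronglyMeasurable[A.history t ⊔ A.sampleAlg t] g ∧
      Pr⟦B | A.history t ⊔ A.sampleAlg t ⊔ A.truthAlg⟧ =ᵐ[Pr] g := by
  classical
  obtain ⟨U, -, rfl⟩ := hB
  let s : X × P → Set Ω := fun q => {ω | A.arm t ω = q.1 ∧ A.prior t ω = q.2}
  have hs : ∀ q, MeasurableSet (s q) := fun q => hA.measurable_choice t ht q.1 q.2
  have hsum : ((fun ω => (A.arm t ω, A.prior t ω)) ⁻¹' U).indicator (fun _ => (1 : ℝ)) =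
      ∑ q ∈ Finset.univ.filter (· ∈ U), (s q).indicator fun _ => 1 := by
    ext ω
    rw [Finset.sum_apply, Finset.sum_filter, Finset.sum_eq_single (A.arm t ω, A.prior t ω)]
    · simp [Set.indicator_apply, s]
    · rintro ⟨x, p⟩ - hq
      split_ifs
      · rw [Set.indicator_of_notMem]
        rintro ⟨h1, h2⟩
        exact hq (Prod.ext h1.symm h2.symm)
      · rfl
    · simp
  refine ⟨∑ q ∈ Finset.univ.filter (· ∈ U), Pr⟦s q | A.history t ⊔ A.sampleAlg t⟧,
    Finset.stronglyMeasurable_sum _ fun q _ => stronglyMeasurable_condExp, ?_⟩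
  rw [hsum]
  refine (condExp_finsetSum (fun q _ => (integrable_const (1 : ℝ)).indicator (hs q)) _).trans ?_
  have h : ∀ᵐ ω ∂Pr, ∀ q, (Pr⟦s q | A.history t ⊔ A.sampleAlg t ⊔ A.truthAlg⟧) ω =
      (Pr⟦s q | A.history t ⊔ A.sampleAlg t⟧) ω :=
    ae_all_iff.2 fun q => hA.tie_breaking t ht q.1 q.2
  filter_upwards [h] with ω hω
  simp only [Finset.sum_apply, hω]

end IsRun

end Run


/-! ### The posterior of the expected reward function -/

namespace Bandit

variable {Ω X P : Type*} (A : Bandit Ω X P)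

/-- What is known before the reward of round `t` is observed. -/
abbrev preReward (t : ℕ) : MeasurableSpace Ω := A.history t ⊔ A.sampleAlg t ⊔ A.choiceAlg t

/-- The error of the posterior mean for prior `p` before round `t`. -/
def residual (μ : P → X → ℝ) (k : P → X → X → ℝ) (σ : ℝ) (p : P) (t : ℕ) (ω : Ω) : X → ℝ :=
  A.f ω - A.mean μ k σ t p ω

theorem measurable_residual [Finite X] (μ : P → X → ℝ) (k : P → X → X → ℝ) (σ : ℝ) (p : P)
    (t : ℕ) : Measurable[A.history t ⊔ A.truthAlg] (A.residual μ k σ p t) := by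
  have h1 : Measurable[A.history t ⊔ A.truthAlg] A.f :=
    (comap_measurable A.f).mono le_sup_right le_rfl
  have h2 : Measurable[A.history t ⊔ A.truthAlg] fun ω p => A.mean μ k σ t p ω :=
    (A.measurable_mean_history μ k σ t).mono le_sup_left le_rfl
  let _ : MeasurableSpace Ω := A.history t ⊔ A.truthAlg
  exact h1.sub ((measurable_pi_apply p).comp h2)

variable {A}

/-- The posterior kernel of the next round, given the arms selected so far. -/
theorem postKernel_succ [Finite X] {k : X → X → ℝ} (hk : (Matrix.of k).PosSemidef) {σ : ℝ}
    (hσ : 0 < σ) {t : ℕ} (ht : 1 ≤ t) (a : Finset.Ico 1 t → X) (b : X)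
    (a' : Finset.Ico 1 (t + 1) → X) (ha : ∀ i, a' (icoSuccEquiv t ht (some i)) = a i)
    (hb : a' (icoSuccEquiv t ht none) = b) (x x' : X) :
    postKernel k σ a' x x' = postKernel k σ a x x' -
      postKernel k σ a x b / (postKernel k σ a b b + σ ^ 2) * postKernel k σ a b x' := by
  rw [← postKernel_comp k σ a' (icoSuccEquiv t ht), postKernel_option hk hσ]
  have h1 : (a' ∘ icoSuccEquiv t ht) ∘ some = a := funext ha
  have h2 : (a' ∘ icoSuccEquiv t ht) none = b := hb
  rw [h1, h2]

/-- The innovation equals the old residual at the selected arm plus the noise, so this recursion has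
exactly the shape of `map_innovation_residual`. -/
theorem residual_succ [Finite X] (μ : P → X → ℝ) {k : P → X → X → ℝ} {p : P}
    (hk : (Matrix.of (k p)).PosSemidef) {σ : ℝ} (hσ : 0 < σ) {t : ℕ} (ht : 1 ≤ t) (ω : Ω) (x : X) :
    A.residual μ k σ p (t + 1) ω x = A.residual μ k σ p t ω x -
      A.kernel k σ t p ω x (A.arm t ω) /
        (A.kernel k σ t p ω (A.arm t ω) (A.arm t ω) + σ ^ 2) *
        (A.residual μ k σ p t ω (A.arm t ω) + A.noise t ω) := by
  have h := postMean_option hk hσ (μ p)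
    ((fun i : Finset.Ico 1 (t + 1) => A.arm i ω) ∘ icoSuccEquiv t ht)
    ((fun i : Finset.Ico 1 (t + 1) => A.reward i ω) ∘ icoSuccEquiv t ht) x
  rw [postMean_comp] at h
  change A.mean μ k σ (t + 1) p ω x = A.mean μ k σ t p ω x +
    A.kernel k σ t p ω x (A.arm t ω) /
        (A.kernel k σ t p ω (A.arm t ω) (A.arm t ω) + σ ^ 2) *
      (A.reward t ω - A.mean μ k σ t p ω (A.arm t ω)) at h
  simp only [residual, Pi.sub_apply, h, reward]
  ring

end Bandit

namespace IsRun

variable {Ω X P : Type*} [Fintype X] [DecidableEq X] [Fintype P] [DecidableEq P]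
    [mΩ : MeasurableSpace Ω] {Pr : Measure Ω} [IsProbabilityMeasure Pr] {μ : P → X → ℝ}
    {k : P → X → X → ℝ} {σ : ℝ} {β ξ : ℕ → ℝ} {T : ℕ} {pstar : P} {A : Bandit Ω X P}
    (hA : IsRun Pr μ k σ β ξ T pstar A)
include hA

omit [IsProbabilityMeasure Pr] in
theorem residual_law_one (hk : ∀ p, (Matrix.of (k p)).PosSemidef) {D : Set (X → ℝ)}
    (hD : MeasurableSet D) :
    Pr (A.residual μ k σ pstar 1 ⁻¹' D) = gpLaw 0 (k pstar) D := by
  have hemp : IsEmpty (Finset.Ico 1 1) := ⟨fun i => by have := Finset.mem_Ico.1 i.2; omega⟩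
  have h1 : A.residual μ k σ pstar 1 = (fun r => r - μ pstar) ∘ A.f := by
    ext ω x
    simp [Bandit.residual, Bandit.mean, postMean, dotProduct]
  rw [h1, ← map_sub_gpLaw (μ pstar) (hk pstar), ← hA.law_f, Measure.map_map (by fun_prop)
    hA.measurable_f, Measure.map_apply ((by fun_prop : Measurable fun r : X → ℝ => r - μ pstar).comp
    hA.measurable_f) hD]

/-- Given what is known before the reward of round `t` is observed, and given the arms `a` selected
before, the error of the posterior mean is a Gaussian process with the posterior kernel. -/
theorem residual_law_choice {t : ℕ} (ht : t ∈ Finset.Icc 1 T) (a : Finset.Ico 1 t → X)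
    {D : Set (X → ℝ)} (hD : MeasurableSet D)
    (h : ∀ E, MeasurableSet[A.history t] E →
      Pr (E ∩ ({ω | A.arms t ω = a} ∩ A.residual μ k σ pstar t ⁻¹' D)) =
        gpLaw 0 (postKernel (k pstar) σ a) D * Pr (E ∩ {ω | A.arms t ω = a})) :
    ∀ E, MeasurableSet[A.preReward t] E →
      Pr (E ∩ ({ω | A.arms t ω = a} ∩ A.residual μ k σ pstar t ⁻¹' D)) =
        gpLaw 0 (postKernel (k pstar) σ a) D * Pr (E ∩ {ω | A.arms t ω = a}) := by
  have htT : t ≤ T + 1 := by have := Finset.mem_Icc.1 ht; omega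
  have hH := hA.history_le htT
  have hS := hA.sampleAlg_le ht
  have hC := hA.choiceAlg_le ht
  have hF := hA.truthAlg_le
  have hc : gpLaw 0 (postKernel (k pstar) σ a) D ≠ ⊤ := measure_ne_top _ _
  have hR := A.measurable_residual μ k σ pstar t hD
  -- The samples are adjoined before the choice, because the choice is uninformative about `f` only
  -- once the samples are known.
  have h1 := measure_inter_eq_of_condIndep le_sup_left (sup_le hH hF) hS Pr (hA.condExp_sample ht)
    (A.measurableSet_arms_history t a) hR hc h
  exact measure_inter_eq_of_condIndep le_sup_left (sup_le (sup_le hH hS) hF) hC Pr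
    (hA.condExp_choice ht) ((le_sup_left : A.history t ≤ _) _ (A.measurableSet_arms_history t a))
    ((sup_le_sup_right le_sup_left A.truthAlg :
      A.history t ⊔ A.truthAlg ≤ A.history t ⊔ A.sampleAlg t ⊔ A.truthAlg) _ hR) hc h1

/-- Once the arm is fixed to `b`, observing the reward amounts to observing the innovation `ρ`, and
the new residual is independent of `ρ` and of what was known before. Hence conditioning on the
larger history does not change its law. -/
theorem residual_law_succ (hk : ∀ p, (Matrix.of (k p)).PosSemidef) (hσ : 0 < σ) {t : ℕ}
    (ht : t ∈ Finset.Icc 1 T) (a : Finset.Ico 1 t → X) (b : X)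
    (h : ∀ D : Set (X → ℝ), MeasurableSet D → ∀ E,
      MeasurableSet[A.preReward t] E →
      Pr (E ∩ ({ω | A.arms t ω = a} ∩ A.residual μ k σ pstar t ⁻¹' D)) =
        gpLaw 0 (postKernel (k pstar) σ a) D * Pr (E ∩ {ω | A.arms t ω = a}))
    {k' : X → X → ℝ} (hk' : (Matrix.of k').PosSemidef)
    (hkk : ∀ x x', k' x x' = postKernel (k pstar) σ a x x' -
      postKernel (k pstar) σ a x b / (postKernel (k pstar) σ a b b + σ ^ 2) *
        postKernel (k pstar) σ a b x')
    {D : Set (X → ℝ)} (hD : MeasurableSet D) {E : Set Ω} (hE : MeasurableSet[A.history (t + 1)] E) :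
    Pr (E ∩ (({ω | A.arms t ω = a} ∩ {ω | A.arm t ω = b}) ∩
        A.residual μ k σ pstar (t + 1) ⁻¹' D)) =
      gpLaw 0 k' D * Pr (E ∩ ({ω | A.arms t ω = a} ∩ {ω | A.arm t ω = b})) := by
  have ht1 : 1 ≤ t := (Finset.mem_Icc.1 ht).1
  have htT : t ≤ T := (Finset.mem_Icc.1 ht).2
  have hGm : A.preReward t ≤ mΩ := sup_le (sup_le (hA.history_le (by omega)) (hA.sampleAlg_le ht))
    (hA.choiceAlg_le ht)
  have hHG : A.history t ≤ A.preReward t := le_sup_left.trans le_sup_left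
  have hFm := hA.truthAlg_le
  let A' : Set Ω := {ω | A.arms t ω = a} ∩ {ω | A.arm t ω = b}
  have hA'G : MeasurableSet[A.preReward t] A' := (hHG _ (A.measurableSet_arms_history t a)).inter
    ((le_sup_right : A.choiceAlg t ≤ A.preReward t) _ (A.measurableSet_choice {q : X × P | q.1 = b}))
  let K := postKernel (k pstar) σ a
  have hK : (Matrix.of K).PosSemidef := postKernel_posSemidef (hk pstar) hσ a
  let R := A.residual μ k σ pstar t
  have hRG : Measurable[A.preReward t ⊔ A.truthAlg] R :=
    (A.measurable_residual μ k σ pstar t).mono (sup_le_sup_right hHG _) le_rfl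
  have hRm : Measurable R := hRG.mono (sup_le hGm hFm) le_rfl
  let v : NNReal := (σ ^ 2).toNNReal
  have hv : v ≠ 0 := by
    have : 0 < v := Real.toNNReal_pos.2 (by positivity)
    exact this.ne'
  have hvσ : (v : ℝ) = σ ^ 2 := Real.coe_toNNReal _ (sq_nonneg _)
  let φ : (X → ℝ) × ℝ → ℝ × (X → ℝ) := fun q =>
    (q.1 b + q.2, fun x => q.1 x - K x b / (K b b + v) * (q.1 b + q.2))
  have hφ : Measurable φ := by
    have h1 : Measurable fun q : (X → ℝ) × ℝ => q.1 b + q.2 := by fun_prop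
    exact h1.prodMk (by fun_prop)
  let ρ : Ω → ℝ := fun ω => A.reward t ω - A.mean μ k σ t pstar ω b
  have hmb : Measurable[A.history t] fun ω => A.mean μ k σ t pstar ω b :=
    (measurable_pi_apply b).comp ((measurable_pi_apply pstar).comp
      (A.measurable_mean_history μ k σ t))
  have hρm : Measurable ρ := (hA.measurable_reward ht).sub
    (hmb.mono (hA.history_le (by omega)) le_rfl)
  have hR'm : Measurable (A.residual μ k σ pstar (t + 1)) :=
    (A.measurable_residual μ k σ pstar (t + 1)).mono
      (sup_le (hA.history_le (by omega)) hFm) le_rfl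
  have hφA : ∀ ω ∈ A', φ (R ω, A.noise t ω) = (ρ ω, A.residual μ k σ pstar (t + 1) ω) := by
    rintro ω ⟨h1, h2⟩
    have hker : A.kernel k σ t pstar ω = K := by
      change postKernel (k pstar) σ (A.arms t ω) = _
      rw [show A.arms t ω = a from h1]
    have harm : A.arm t ω = b := h2
    ext x
    · simp only [φ, ρ, R, Bandit.residual, Pi.sub_apply, Bandit.reward, harm]
      ring
    · change _ = A.residual μ k σ pstar (t + 1) ω x
      rw [Bandit.residual_succ μ (hk pstar) hσ ht1, harm, hker]
      simp only [φ, hvσ, R]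
  -- The reward is `ρ` plus a function of the history. Since `ρ` is centred at the fixed arm `b`,
  -- this holds everywhere and not only where `b` is selected.
  have hle : A.history (t + 1) ≤ A.preReward t ⊔ MeasurableSpace.comap ρ inferInstance := by
    rw [A.history_succ ht1]
    refine sup_le le_sup_left ?_
    have h1 : Measurable[A.preReward t ⊔ MeasurableSpace.comap ρ inferInstance] ρ :=
      (comap_measurable ρ).mono le_sup_right le_rfl
    have h2 : Measurable[A.preReward t ⊔ MeasurableSpace.comap ρ inferInstance]
        fun ω => A.mean μ k σ t pstar ω b := hmb.mono (hHG.trans le_sup_left) le_rfl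
    have h3 : A.reward t = fun ω => ρ ω + A.mean μ k σ t pstar ω b := by
      ext ω
      simp [ρ]
    rw [h3]
    exact (Measurable.add (f := ρ) (g := fun ω => A.mean μ k σ t pstar ω b)
      (m := A.preReward t ⊔ MeasurableSpace.comap ρ inferInstance) h1 h2).comap_le
  -- On each prior event inside the fibre, innovation and new residual have a product law whose
  -- normalised form does not depend on `E1`.
  have key : ∀ E1, MeasurableSet[A.preReward t] E1 → (Pr.restrict (E1 ∩ A')).map
      (fun ω => (ρ ω, A.residual μ k σ pstar (t + 1) ω)) =
      Pr (E1 ∩ A') • ((((gpLaw 0 K).prod (gaussianReal 0 v)).map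
        fun q => q.1 b + q.2).prod (gpLaw 0 k')) := by
    intro E1 hE1
    have hEA := hE1.inter hA'G
    have h1 : (Pr.restrict (E1 ∩ A')).map R = Pr (E1 ∩ A') • gpLaw 0 K := by
      ext D hD
      have h2 := h D hD (E1 ∩ A') hEA
      rw [Measure.map_apply hRm hD, Measure.restrict_apply (hRm hD), Measure.smul_apply,
        smul_eq_mul, mul_comm]
      have h3 : E1 ∩ A' ∩ {ω | A.arms t ω = a} = E1 ∩ A' :=
        Set.inter_eq_left.2 fun ω hω => hω.2.1
      rw [← Set.inter_assoc, h3, Set.inter_comm] at h2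
      exact h2
    have h2 := map_restrict_prodMk_of_indep (sup_le hGm hFm) Pr (hA.measurable_noise t ht)
      (hA.indep_noise t ht) hRG ((le_sup_left : A.preReward t ≤ A.preReward t ⊔ A.truthAlg) _ hEA)
    rw [h1, hA.law_noise t ht, Measure.prod_smul_left] at h2
    have h4 : (Pr.restrict (E1 ∩ A')).map (fun ω => (ρ ω, A.residual μ k σ pstar (t + 1) ω)) =
        (Pr.restrict (E1 ∩ A')).map (φ ∘ fun ω => (R ω, A.noise t ω)) := by
      apply Measure.map_congr
      filter_upwards [ae_restrict_mem (hGm _ hEA)] with ω hω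
      exact (hφA ω hω.2).symm
    rw [h4, ← Measure.map_map hφ (hRm.prodMk (hA.measurable_noise t ht)), h2, Measure.map_smul,
      map_innovation_residual hK v hv b hk' fun x x' => by rw [hvσ]; exact hkk x x']
  have hrect : ∀ E1 C D, MeasurableSet[A.preReward t] E1 → MeasurableSet C → MeasurableSet D →
      Pr (E1 ∩ ρ ⁻¹' C ∩ (A' ∩ A.residual μ k σ pstar (t + 1) ⁻¹' D)) = Pr (E1 ∩ A') *
        (((gpLaw 0 K).prod (gaussianReal 0 v)).map (fun q => q.1 b + q.2) C * gpLaw 0 k' D) := by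
    intro E1 C D hE1 hC hD
    have h1 := congrArg (fun ν => ν (C ×ˢ D)) (key E1 hE1)
    simp only [Measure.smul_apply, smul_eq_mul] at h1
    rw [Measure.map_apply (hρm.prodMk hR'm) (hC.prod hD), Measure.restrict_apply
      ((hρm.prodMk hR'm) (hC.prod hD)), Measure.prod_prod] at h1
    rw [← h1]
    congr 1
    ext ω
    simp only [Set.mem_inter_iff, Set.mem_preimage, Set.mem_prod]
    tauto
  have hfin := measure_eq_of_eq_inter hGm hρm.comap_le
    (Pr.restrict (A' ∩ A.residual μ k σ pstar (t + 1) ⁻¹' D)) (gpLaw 0 k' D • Pr.restrict A') ?_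
    (hle _ hE)
  · have hEm := hA.history_le (by omega) _ hE
    rw [Measure.smul_apply, Measure.restrict_apply hEm, Measure.restrict_apply hEm] at hfin
    exact hfin
  · rintro E1 _ hE1 ⟨C, hC, rfl⟩
    have hm : MeasurableSet (E1 ∩ ρ ⁻¹' C) := (hGm _ hE1).inter (hρm hC)
    have h1 := hrect E1 C Set.univ hE1 hC MeasurableSet.univ
    rw [Set.preimage_univ, Set.inter_univ, measure_univ, mul_one] at h1
    rw [Measure.smul_apply, Measure.restrict_apply hm, Measure.restrict_apply hm,
      hrect E1 C D hE1 hC hD, h1, smul_eq_mul]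
    ring

/-- Given the history and the arms `a` selected so far, the error of the posterior mean for the
prior `pstar` is a Gaussian process with the posterior kernel. -/
theorem residual_law (hk : ∀ p, (Matrix.of (k p)).PosSemidef) (hσ : 0 < σ) {t : ℕ} (ht : 1 ≤ t)
    (htT : t ≤ T + 1) (a : Finset.Ico 1 t → X) {D : Set (X → ℝ)} (hD : MeasurableSet D) {E : Set Ω}
    (hE : MeasurableSet[A.history t] E) :
    Pr (E ∩ ({ω | A.arms t ω = a} ∩ A.residual μ k σ pstar t ⁻¹' D)) =
      gpLaw 0 (postKernel (k pstar) σ a) D * Pr (E ∩ {ω | A.arms t ω = a}) := by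
  induction t, ht using Nat.le_induction generalizing D E with
  | base =>
    have hemp : IsEmpty (Finset.Ico 1 1) := ⟨fun i => by have := Finset.mem_Ico.1 i.2; omega⟩
    have h1 : {ω | A.arms 1 ω = a} = Set.univ := Set.eq_univ_of_forall fun ω =>
      Subsingleton.elim _ _
    have h2 : postKernel (k pstar) σ a = k pstar := by
      ext x x'
      simp [postKernel, dotProduct]
    have h3 : A.history 1 = ⊥ := by simp [Bandit.history]
    rw [h3, MeasurableSpace.measurableSet_bot_iff] at hE
    rw [h1, h2, Set.univ_inter, Set.inter_univ]
    rcases hE with rfl | rfl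
    · simp
    · rw [Set.univ_inter, hA.residual_law_one hk hD, measure_univ, mul_one]
  | succ t ht ih =>
    have ht' : t ∈ Finset.Icc 1 T := Finset.mem_Icc.2 ⟨ht, by omega⟩
    let a₀ : Finset.Ico 1 t → X := fun i => a (icoSuccEquiv t ht (some i))
    let b : X := a (icoSuccEquiv t ht none)
    have hset : {ω | A.arms (t + 1) ω = a} = {ω | A.arms t ω = a₀} ∩ {ω | A.arm t ω = b} := by
      ext ω
      simp only [Set.mem_inter_iff, Set.mem_ofPred_eq, funext_iff]
      rw [← (icoSuccEquiv t ht).forall_congr_right, Option.forall, and_comm]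
      rfl
    rw [hset]
    exact hA.residual_law_succ hk hσ ht' a₀ b (fun D hD => hA.residual_law_choice ht' a₀ hD
      fun E hE => ih (by omega) a₀ hD hE) (postKernel_posSemidef (hk pstar) hσ a)
      (Bandit.postKernel_succ (hk pstar) hσ ht a₀ b a (fun _ => rfl) rfl) hD hE

end IsRun


/-! ### Concentration of the reward function and of the samples -/

/-- Applied to the past arms: posterior variances are deterministic only on a fibre, so tail bounds
are proved there and added up. -/
theorem measure_le_of_forall_inter_fiber {Ω ι : Type*} [Finite ι] [MeasurableSpace Ω]
    (Pr : Measure Ω) [IsProbabilityMeasure Pr] {a : Ω → ι} (ha : ∀ i, MeasurableSet {ω | a ω = i})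
    {D : Set Ω} {q : ENNReal} (h : ∀ i, Pr ({ω | a ω = i} ∩ D) ≤ q * Pr {ω | a ω = i}) :
    Pr D ≤ q := by
  have := Fintype.ofFinite ι
  have hD : D ⊆ ⋃ i, {ω | a ω = i} ∩ D := fun ω hω => by simpa using hω
  have hun : ⋃ i, {ω | a ω = i} = Set.univ := by
    ext ω
    simp
  have hdis : Pairwise (Function.onFun Disjoint fun i => {ω | a ω = i}) := fun i j hij =>
    Set.disjoint_left.2 fun ω (h1 : a ω = i) (h2 : a ω = j) => hij (h1.symm.trans h2)
  calc Pr D ≤ ∑ i, Pr ({ω | a ω = i} ∩ D) :=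
        (measure_mono hD).trans (measure_iUnion_fintype_le _ _)
    _ ≤ ∑ i, q * Pr {ω | a ω = i} := Finset.sum_le_sum fun i _ => h i
    _ = q := by
      have h1 := measure_iUnion (μ := Pr) hdis ha
      rw [hun, measure_univ, tsum_fintype] at h1
      rw [← Finset.mul_sum, ← h1, mul_one]

namespace IsRun

variable {Ω X P : Type*} [Fintype X] [DecidableEq X] [Fintype P] [DecidableEq P]
    [mΩ : MeasurableSpace Ω] {Pr : Measure Ω} [IsProbabilityMeasure Pr] {μ : P → X → ℝ}
    {k : P → X → X → ℝ} {σ : ℝ} {β ξ : ℕ → ℝ} {T : ℕ} {pstar : P} {A : Bandit Ω X P}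
    (hA : IsRun Pr μ k σ β ξ T pstar A)
include hA

theorem measure_truth_tail_le (hk : ∀ p, (Matrix.of (k p)).PosSemidef) (hσ : 0 < σ) {t : ℕ}
    (ht : t ∈ Finset.Icc 1 T) (x : X) {c : ℝ} (hc : 0 ≤ c) :
    Pr {ω | c * √(A.var k σ t pstar ω x) < |A.f ω x - A.mean μ k σ t pstar ω x|} ≤
      ENNReal.ofReal (Real.exp (-c ^ 2 / 2)) := by
  obtain ⟨ht1, htT⟩ := Finset.mem_Icc.1 ht
  refine measure_le_of_forall_inter_fiber Pr (a := A.arms t)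
    (fun a => hA.history_le (by omega) _ (A.measurableSet_arms_history t a)) fun a => ?_
  have hK := postKernel_posSemidef (hk pstar) hσ a
  let K := postKernel (k pstar) σ a
  have hK0 : 0 ≤ K x x := hK.diag_nonneg (i := x)
  let D : Set (X → ℝ) := {r | c * √(K x x) < |r x|}
  have hD : MeasurableSet D := measurableSet_lt (by fun_prop) (by fun_prop)
  have h := hA.residual_law hk hσ ht1 (by omega) a hD (E := Set.univ) MeasurableSet.univ
  have hset : {ω | A.arms t ω = a} ∩
      {ω | c * √(A.var k σ t pstar ω x) < |A.f ω x - A.mean μ k σ t pstar ω x|} =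
      {ω | A.arms t ω = a} ∩ A.residual μ k σ pstar t ⁻¹' D := by
    ext ω
    refine and_congr_right fun hω => ?_
    have hv : A.var k σ t pstar ω x = K x x := by
      change postKernel (k pstar) σ (A.arms t ω) x x = _
      rw [show A.arms t ω = a from hω]
    simp only [Set.mem_ofPred_eq, hv, Set.mem_preimage, D, Bandit.residual, Pi.sub_apply]
  rw [Set.univ_inter, Set.univ_inter] at h
  rw [hset, h]
  gcongr
  have h1 := gaussianReal_tail 0 (K x x).toNNReal hc
  rw [← Pi.zero_apply (M := fun _ : X => ℝ) x, ← map_eval_gpLaw 0 hK x, Measure.map_apply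
    (by fun_prop) (measurableSet_lt (by fun_prop) (by fun_prop)), Real.coe_toNNReal _ hK0] at h1
  simpa [D] using h1

theorem measure_sample_tail_le (hk : ∀ p, (Matrix.of (k p)).PosSemidef) (hσ : 0 < σ) {t : ℕ}
    (ht : t ∈ Finset.Icc 1 T) (p : P) (x : X) {c : ℝ} (hc : 0 ≤ c) :
    Pr {ω | c * √(A.var k σ t p ω x) < |A.sample t ω p x - A.mean μ k σ t p ω x|} ≤
      ENNReal.ofReal (Real.exp (-c ^ 2 / 2)) := by
  obtain ⟨ht1, htT⟩ := Finset.mem_Icc.1 ht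
  have hH := hA.history_le (show t ≤ T + 1 by omega)
  refine measure_le_of_forall_inter_fiber Pr (a := A.arms t)
    (fun a => hH _ (A.measurableSet_arms_history t a)) fun a => ?_
  have hK := postKernel_posSemidef (hk p) hσ a
  let K := postKernel (k p) σ a
  have hK0 : 0 ≤ K x x := hK.diag_nonneg (i := x)
  have hM : Measurable[A.history t] fun ω => A.mean μ k σ t p ω x :=
    (measurable_pi_apply x).comp ((measurable_pi_apply p).comp
      (A.measurable_mean_history μ k σ t))
  have hY : Measurable fun ω => A.sample t ω p x :=
    (measurable_pi_apply x).comp ((measurable_pi_apply p).comp (hA.measurable_sample t ht))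
  have hker : ∀ ω, A.arms t ω = a → A.kernel k σ t p ω = K := by
    intro ω hω
    change postKernel (k p) σ (A.arms t ω) = _
    rw [hω]
  have hset : {ω | A.arms t ω = a} ∩
      {ω | c * √(A.var k σ t p ω x) < |A.sample t ω p x - A.mean μ k σ t p ω x|} =
      {ω | A.arms t ω = a} ∩
      {ω | c * √((K x x).toNNReal : ℝ) < |A.sample t ω p x - A.mean μ k σ t p ω x|} := by
    ext ω
    refine and_congr_right fun hω => ?_
    simp only [Set.mem_ofPred_eq, Bandit.var, hker ω hω, Real.coe_toNNReal _ hK0]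
  rw [hset]
  refine measure_inter_tail_le Pr (hM.mono hH le_rfl) hY _ (fun B C hB hC => ?_) hc
  have hF : MeasurableSet[A.history t] ({ω | A.arms t ω = a} ∩
      (fun ω => A.mean μ k σ t p ω x) ⁻¹' C) := (A.measurableSet_arms_history t a).inter (hM hC)
  have hB' : MeasurableSet {z : P → X → ℝ | z p x ∈ B} :=
    ((measurable_pi_apply x).comp (measurable_pi_apply p) :
      Measurable fun z : P → X → ℝ => z p x) hB
  have hn : A.history t ⊔ A.truthAlg ≤ mΩ := sup_le hH hA.truthAlg_le
  have hS := hA.measurable_sample t ht hB'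
  have h1 := setIntegral_condExp hn (((integrable_const (1 : ℝ)).indicator hS) :
    Integrable _ Pr) ((le_sup_left : A.history t ≤ A.history t ⊔ A.truthAlg) _ hF)
  rw [setIntegral_indicator hS] at h1
  have h2 : Pr.real ({ω | A.arms t ω = a} ∩ (fun ω => A.mean μ k σ t p ω x) ⁻¹' C ∩
      (fun ω => A.sample t ω p x) ⁻¹' B) = ∫ _ in {ω | A.arms t ω = a} ∩
      (fun ω => A.mean μ k σ t p ω x) ⁻¹' C ∩ A.sample t ⁻¹' {z | z p x ∈ B}, (1 : ℝ) ∂Pr := by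
    simp [Measure.real]
    rfl
  rw [h2, ← h1]
  refine setIntegral_congr_ae (hH _ hF) ?_
  filter_upwards [hA.law_sample t ht _ hB'] with ω hω hωF
  rw [hω]
  have h3 := (measurePreserving_eval (fun q => gpLaw (A.mean μ k σ t q ω) (A.kernel k σ t q ω))
    p).measure_preimage (s := {r | r x ∈ B}) ((measurable_pi_apply x) hB).nullMeasurableSet
  have h4 := map_eval_gpLaw (A.mean μ k σ t p ω) hK x
  rw [Measure.real, Measure.real, ← h4, Measure.map_apply (by fun_prop) hB]
  rw [hker ω hωF.1] at h3
  exact congrArg _ h3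

end IsRun


/-! ### Concentration of predictable sums of noise -/

/-- Gaussian convolution, written as the one-step martingale identity for
`measure_predictable_sum_le`. -/
theorem lintegral_gaussianReal_add (m : ℝ) (v w : NNReal) {C : Set ℝ} (hC : MeasurableSet C) :
    ∫⁻ z, gaussianReal (m + z) w C ∂(gaussianReal 0 v) = gaussianReal m (v + w) C := by
  have h := gaussianReal_conv_gaussianReal (m₁ := 0) (m₂ := m) (v₁ := v) (v₂ := w)
  rw [zero_add] at h
  rw [← h, Measure.conv, Measure.map_apply (by fun_prop) hC,
    Measure.prod_apply ((by fun_prop : Measurable fun q : ℝ × ℝ => q.1 + q.2) hC)]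
  refine lintegral_congr fun z => ?_
  rw [add_comm m z, add_comm z m, ← gaussianReal_map_const_add z,
    Measure.map_apply (by fun_prop) hC]
  rfl

/-- Sums of Gaussian noise over at most `n` predictably chosen rounds: on the event that exactly `n`
rounds are chosen, the law of the sum is dominated by that of `n` independent terms. -/
theorem measure_predictable_sum_le {Ω : Type*} {mΩ : MeasurableSpace Ω} (Pr : Measure Ω)
    [IsProbabilityMeasure Pr] {T : ℕ} {ℱ : ℕ → MeasurableSpace Ω} {e : ℕ → Ω → ℝ} {b : ℕ → Set Ω}
    {v : NNReal} {n : ℕ} (hℱ : ∀ t ∈ Finset.Icc 1 T, ℱ t ≤ mΩ)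
    (he : ∀ t ∈ Finset.Icc 1 T, Measurable (e t))
    (hlaw : ∀ t ∈ Finset.Icc 1 T, Pr.map (e t) = gaussianReal 0 v)
    (hind : ∀ t ∈ Finset.Icc 1 T, Indep (MeasurableSpace.comap (e t) inferInstance) (ℱ t) Pr)
    (hpast : ∀ t ∈ Finset.Icc 1 T, ∀ i ∈ Finset.Ico 1 t, Measurable[ℱ t] (e i))
    (hb : ∀ t ∈ Finset.Icc 1 T, ∀ i ∈ Finset.Icc 1 t, MeasurableSet[ℱ t] (b i))
    (hcap : ∀ ω, ∑ i ∈ Finset.Icc 1 T, (b i).indicator (fun _ => 1) ω ≤ n)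
    {C : Set ℝ} (hC : MeasurableSet C) :
    Pr {ω | ∑ i ∈ Finset.Icc 1 T, (b i).indicator (fun _ => 1) ω = n ∧
        ∑ i ∈ Finset.Icc 1 T, (b i).indicator (e i) ω ∈ C} ≤ gaussianReal 0 (n * v) C := by
  let N : ℕ → Ω → ℕ := fun t ω => ∑ i ∈ Finset.Icc 1 t, (b i).indicator (fun _ => 1) ω
  let M : ℕ → Ω → ℝ := fun t ω => ∑ i ∈ Finset.Icc 1 t, (b i).indicator (e i) ω
  -- `g (M t, N t)` is the probability of ending in `C` if the terms still missing from `n` were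
  -- independent Gaussians. It is a martingale, and its starting value is the claimed bound.
  let g : ℝ × ℕ → ENNReal := fun q => gaussianReal q.1 ((n - q.2 : ℕ) * v) C
  have hg : Measurable g :=
    (Measure.measurable_coe hC).comp (measurable_gaussianReal.comp
      (measurable_fst.prodMk ((measurable_of_countable fun j : ℕ => (((n - j : ℕ) : NNReal) * v)).comp
        measurable_snd)))
  have hinv : ∀ t ≤ T, ∫⁻ ω, g (M t ω, N t ω) ∂Pr = gaussianReal 0 (n * v) C := by
    intro t
    induction t with
    | zero => simp [g, M, N]
    | succ t ih =>
      intro htT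
      have ht : t + 1 ∈ Finset.Icc 1 T := Finset.mem_Icc.2 ⟨by omega, htT⟩
      have hQ : Measurable[ℱ (t + 1)] fun ω => (M t ω, N t ω) := by
        refine Measurable.prodMk (Finset.measurable_fun_sum _ fun i hi => ?_)
          (Finset.measurable_fun_sum _ fun i hi => ?_)
        · exact (hpast _ ht i (by simp at hi ⊢; omega)).indicator
            (hb _ ht i (by simp at hi ⊢; omega))
        · exact measurable_const.indicator (hb _ ht i (by simp at hi ⊢; omega))
      have hb1 := hb _ ht (t + 1) (by simp)
      have hb2 : MeasurableSet (b (t + 1)) := hℱ _ ht _ hb1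
      -- The cap keeps the truncated subtraction in `g` honest: a chosen round really uses up one
      -- unit of the remaining variance.
      have hlt : ∀ ω ∈ b (t + 1), N t ω + 1 ≤ n := by
        intro ω hω
        refine le_trans ?_ (hcap ω)
        calc N t ω + 1 = N (t + 1) ω := by
              simp [N, Finset.sum_Icc_succ_top, hω]
          _ ≤ _ := Finset.sum_le_sum_of_subset (Finset.Icc_subset_Icc_right htT)
      have hmap := map_restrict_prodMk_of_indep (hℱ _ ht) Pr (he _ ht) (hind _ ht) hQ hb1
      rw [hlaw _ ht] at hmap
      rw [← ih (by omega), ← lintegral_add_compl _ hb2,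
        ← lintegral_add_compl (fun ω => g (M t ω, N t ω)) hb2]
      congr 1
      · let g' : (ℝ × ℕ) × ℝ → ENNReal := fun q => g (q.1.1 + q.2, q.1.2 + 1)
        have hg' : Measurable g' := hg.comp (by fun_prop)
        have hQm := hQ.mono (hℱ _ ht) le_rfl
        calc ∫⁻ ω in b (t + 1), g (M (t + 1) ω, N (t + 1) ω) ∂Pr
            = ∫⁻ ω in b (t + 1), g' ((M t ω, N t ω), e (t + 1) ω) ∂Pr := by
              refine setLIntegral_congr_fun hb2 fun ω hω => ?_
              simp [g', M, N, Finset.sum_Icc_succ_top, hω]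
          _ = ∫⁻ q, ∫⁻ z, g' (q, z) ∂(gaussianReal 0 v)
                ∂((Pr.restrict (b (t + 1))).map fun ω => (M t ω, N t ω)) := by
              rw [← lintegral_prod _ hg'.aemeasurable, ← hmap,
                lintegral_map hg' (hQm.prodMk (he _ ht))]
          _ = ∫⁻ ω in b (t + 1), g (M t ω, N t ω) ∂Pr := by
              rw [lintegral_map hg'.lintegral_prod_right' hQm]
              refine setLIntegral_congr_fun hb2 fun ω hω => ?_
              simp only [g', g]
              rw [lintegral_gaussianReal_add _ _ _ hC]
              congr 2
              have h1 : n - N t ω = 1 + (n - (N t ω + 1)) := by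
                have := hlt ω hω
                omega
              rw [h1]
              push_cast
              ring
      · refine setLIntegral_congr_fun hb2.compl fun ω hω => ?_
        have hω' : ω ∉ b (t + 1) := hω
        simp [M, N, Finset.sum_Icc_succ_top, hω']
  have hMm : Measurable (M T) := Finset.measurable_fun_sum _ fun i hi =>
    (he i hi).indicator (hℱ i hi _ (hb i hi i (by simp at hi ⊢; omega)))
  have hNm : Measurable (N T) := Finset.measurable_fun_sum _ fun i hi =>
    measurable_const.indicator (hℱ i hi _ (hb i hi i (by simp at hi ⊢; omega)))
  have hE : MeasurableSet {ω | N T ω = n ∧ M T ω ∈ C} :=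
    (hNm (measurableSet_singleton n)).inter (hMm hC)
  rw [← hinv T le_rfl, ← lintegral_indicator_one hE]
  refine lintegral_mono fun ω => ?_
  -- On the event no variance remains, so `g` is a point mass at `M T` evaluated on `C`, which is 1;
  -- elsewhere `g` is nonnegative.
  refine Set.indicator_le (g := fun ω => g (M T ω, N T ω)) (fun ω hω => ?_) ω
  obtain ⟨h1, h2⟩ := hω
  simp [g, h1, h2]

namespace Bandit

variable {Ω X P : Type*} (A : Bandit Ω X P)

theorem preReward_mono {s t : ℕ} (hs : 1 ≤ s) (h : s ≤ t) : A.preReward s ≤ A.preReward t := by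
  rcases h.eq_or_lt with rfl | h
  · exact le_rfl
  · refine le_trans ?_ (le_sup_left.trans le_sup_left : A.history t ≤ A.preReward t)
    exact le_trans (by rw [A.history_succ hs]; exact le_sup_left) (A.history_mono h)

variable [DecidableEq P]

variable {A} in
theorem mem_rounds {i t : ℕ} {p : P} {ω : Ω} :
    i ∈ A.rounds t p ω ↔ (1 ≤ i ∧ i ≤ t) ∧ A.prior i ω = p := by
  rw [rounds, Finset.mem_filter, Finset.mem_Icc]

theorem rounds_succ (t : ℕ) (p : P) (ω : Ω) : A.rounds (t + 1) p ω =
    if A.prior (t + 1) ω = p then insert (t + 1) (A.rounds t p ω) else A.rounds t p ω := by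
  have h : Finset.Icc 1 (t + 1) = insert (t + 1) (Finset.Icc 1 t) := by
    ext i
    simp
    omega
  rw [rounds, h, Finset.filter_insert]
  rfl

theorem rounds_mono {s t : ℕ} (h : s ≤ t) (p : P) (ω : Ω) : A.rounds s p ω ⊆ A.rounds t p ω :=
  Finset.filter_subset_filter _ (Finset.Icc_subset_Icc_right h)

omit [DecidableEq P] in
theorem measurableSet_prior {t : ℕ} (p : P) : MeasurableSet[A.choiceAlg t] {ω | A.prior t ω = p} :=
  A.measurableSet_choice {q : X × P | q.2 = p}

theorem measurable_card_rounds {t : ℕ} (p : P) {s : ℕ} (hs : s ≤ t) :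
    Measurable[A.preReward t] fun ω => (A.rounds s p ω).card := by
  simp only [rounds, Finset.card_filter]
  let _ : MeasurableSpace Ω := A.preReward t
  refine Finset.measurable_fun_sum _ fun i hi => Measurable.ite ?_ measurable_const measurable_const
  have hi' := Finset.mem_Icc.1 hi
  exact A.preReward_mono hi'.1 (by omega) _ ((le_sup_right : A.choiceAlg i ≤ A.preReward i) _
    (A.measurableSet_prior p))

omit [DecidableEq P] in
-- Past noise is recovered as `y_i - f(x_i)`. Thus independence from history and `f` includes
-- independence from the earlier noise.
theorem measurable_noise_preReward [Finite X] {i t : ℕ} (hi : i ∈ Finset.Ico 1 t) :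
    Measurable[A.preReward t ⊔ A.truthAlg] (A.noise i) := by
  have h1 : A.noise i = fun ω => A.reward i ω - A.f ω (A.arm i ω) := by
    ext ω
    simp [reward]
  have hH : A.history t ≤ A.preReward t ⊔ A.truthAlg :=
    le_sup_left.trans (le_sup_left.trans le_sup_left)
  have h2 := (A.measurable_reward_history hi).mono hH le_rfl
  have h3 : Measurable[A.preReward t ⊔ A.truthAlg] A.f :=
    (comap_measurable A.f).mono le_sup_right le_rfl
  rw [h1]
  let _ : MeasurableSpace Ω := A.preReward t ⊔ A.truthAlg
  exact h2.sub (measurable_eval_of_finite (F := fun x ω => A.f ω x)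
    (fun x => (measurable_pi_apply x).comp h3)
    fun x => hH _ (A.measurableSet_choice_history hi {q : X × P | q.1 = x}))

/-- If prior `p` has been selected `n` times up to round `t`, these are the rounds in which it is
selected after less than `n` earlier selections. -/
theorem filter_card_rounds_lt {t T : ℕ} (ht : t ≤ T) (p : P) (ω : Ω) {n : ℕ}
    (hn : (A.rounds t p ω).card = n) :
    (Finset.Icc 1 T).filter (fun i => A.prior i ω = p ∧ (A.rounds (i - 1) p ω).card < n) =
      A.rounds t p ω := by
  ext i
  rw [Finset.mem_filter, mem_rounds, Finset.mem_Icc]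
  constructor
  · rintro ⟨⟨h1, h2⟩, h3, h4⟩
    refine ⟨⟨h1, ?_⟩, h3⟩
    by_contra h
    have := Finset.card_le_card (A.rounds_mono (show t ≤ i - 1 by omega) p ω)
    omega
  · rintro ⟨⟨h1, h2⟩, h3⟩
    refine ⟨⟨h1, by omega⟩, h3, ?_⟩
    have h4 : A.rounds i p ω = insert i (A.rounds (i - 1) p ω) := by
      have := A.rounds_succ (i - 1) p ω
      rwa [Nat.sub_add_cancel h1, if_pos h3] at this
    have h5 : i ∉ A.rounds (i - 1) p ω := by
      rw [mem_rounds]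
      omega
    have h6 := Finset.card_le_card (A.rounds_mono h2 p ω)
    rw [h4, Finset.card_insert_of_notMem h5, hn] at h6
    exact h6

/-- The number of selections grows by at most one per round, so if it exceeds `n` it equals `n` at
some round, where `filter_card_rounds_lt` applies. -/
theorem card_filter_card_rounds_lt_le (T : ℕ) (p : P) (ω : Ω) (n : ℕ) :
    ((Finset.Icc 1 T).filter
      fun i => A.prior i ω = p ∧ (A.rounds (i - 1) p ω).card < n).card ≤ n := by
  by_cases h : (A.rounds T p ω).card ≤ n
  · refine le_trans (Finset.card_le_card fun i hi => ?_) h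
    rw [Finset.mem_filter, Finset.mem_Icc] at hi
    exact mem_rounds.2 ⟨hi.1, hi.2.1⟩
  · push Not at h
    obtain ⟨t, ht, hn⟩ : ∃ t ≤ T, (A.rounds t p ω).card = n := by
      induction T with
      | zero => simp [rounds] at h
      | succ T ih =>
        by_cases h' : n < (A.rounds T p ω).card
        · obtain ⟨t, ht, hn⟩ := ih h'
          exact ⟨t, by omega, hn⟩
        · refine ⟨T, by omega, le_antisymm (not_lt.1 h') ?_⟩
          rw [rounds_succ] at h
          split_ifs at h
          · have := Finset.card_insert_le (T + 1) (A.rounds T p ω)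
            omega
          · omega
    rw [A.filter_card_rounds_lt ht p ω hn, hn]

end Bandit

namespace IsRun

variable {Ω X P : Type*} [Fintype X] [DecidableEq X] [Fintype P] [DecidableEq P]
    [mΩ : MeasurableSpace Ω] {Pr : Measure Ω} [IsProbabilityMeasure Pr] {μ : P → X → ℝ}
    {k : P → X → X → ℝ} {σ : ℝ} {β ξ : ℕ → ℝ} {T : ℕ} {pstar : P} {A : Bandit Ω X P}
    (hA : IsRun Pr μ k σ β ξ T pstar A)
include hA

/-- Indexing by the number `n` of selections covers all rounds `t` with that count at once: whenever
the count is `n`, the sum is the one over the first `n` selections, which is predictable with at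
most `n` terms. -/
theorem measure_noise_tail_le (p : P) (n : ℕ) {c : ℝ} (hc : 0 ≤ c) :
    Pr {ω | ∃ t ≤ T, (A.rounds t p ω).card = n ∧
        c * √(n * σ ^ 2) < |∑ i ∈ A.rounds t p ω, A.noise i ω|} ≤
      ENNReal.ofReal (Real.exp (-c ^ 2 / 2)) := by
  let b : ℕ → Set Ω := fun i => {ω | A.prior i ω = p ∧ (A.rounds (i - 1) p ω).card < n}
  let C : Set ℝ := {z | c * √(n * σ ^ 2) < |z|}
  have hC : MeasurableSet C := measurableSet_lt (by fun_prop) (by fun_prop)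
  have hsum : ∀ {R : Type} [AddCommMonoid R] (F : ℕ → Ω → R) ω,
      ∑ i ∈ Finset.Icc 1 T, (b i).indicator (F i) ω = ∑ i ∈ (Finset.Icc 1 T).filter
        (fun i => A.prior i ω = p ∧ (A.rounds (i - 1) p ω).card < n), F i ω := by
    intro R _ F ω
    classical
    rw [Finset.sum_filter]
    refine Finset.sum_congr rfl fun i _ => ?_
    simp [Set.indicator_apply, b]
  have hℱ : ∀ t ∈ Finset.Icc 1 T, A.preReward t ⊔ A.truthAlg ≤ mΩ := fun t ht =>
    sup_le (sup_le (sup_le (hA.history_le (by have := Finset.mem_Icc.1 ht; omega))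
      (hA.sampleAlg_le ht)) (hA.choiceAlg_le ht)) hA.truthAlg_le
  have h := measure_predictable_sum_le Pr (T := T) (e := A.noise) (b := b) (n := n) hℱ
    hA.measurable_noise hA.law_noise hA.indep_noise
    (fun t _ i hi => A.measurable_noise_preReward hi) (fun t _ i hi => ?_) (fun ω => ?_) hC
  · refine (measure_mono ?_).trans (h.trans ?_)
    · rintro ω ⟨t, ht, hn, hlt⟩
      have h1 := A.filter_card_rounds_lt ht p ω hn
      refine ⟨?_, ?_⟩
      · rw [hsum, h1, Finset.sum_const, hn, smul_eq_mul, mul_one]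
      · rw [hsum, h1]
        exact hlt
    · have h1 := gaussianReal_tail 0 (n * (σ ^ 2).toNNReal) hc
      simp only [sub_zero, NNReal.coe_mul, NNReal.coe_natCast,
        Real.coe_toNNReal _ (sq_nonneg σ)] at h1
      exact h1
  · obtain ⟨hi1, hi2⟩ := Finset.mem_Icc.1 hi
    refine (A.preReward_mono hi1 hi2).trans le_sup_left _ ?_
    exact ((le_sup_right : A.choiceAlg i ≤ A.preReward i) _ (A.measurableSet_prior p)).inter
      (A.measurable_card_rounds p (Nat.sub_le i 1) measurableSet_Iio)
  · rw [hsum, Finset.sum_const, smul_eq_mul, mul_one]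
    exact A.card_filter_card_rounds_lt_le T p ω n

end IsRun


theorem sum_sqrt_le {ι : Type*} (s : Finset ι) {f : ι → ℝ} (hf : ∀ i, 0 ≤ f i) :
    ∑ i ∈ s, √(f i) ≤ √(s.card * ∑ i ∈ s, f i) := by
  have h := Real.sum_sqrt_mul_sqrt_le s (f := fun _ => 1) (fun _ => zero_le_one) hf
  simpa using h

/-! ### The regret on the event that all confidence bounds hold -/

namespace Bandit

variable {Ω X P : Type*} [Fintype P] [DecidableEq P] {A : Bandit Ω X P} {μ : P → X → ℝ}
  {k : P → X → X → ℝ} {σ : ℝ} {β ξ : ℕ → ℝ} {ω : Ω}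

open Classical in
theorem active_succ {t : ℕ} (ht : 1 ≤ t) : A.active μ k σ β ξ ω (t + 1) =
    if A.Eliminates μ k σ β ξ t ω then (A.active μ k σ β ξ ω t).erase (A.prior t ω)
    else A.active μ k σ β ξ ω t := by
  obtain ⟨t, rfl⟩ := Nat.exists_eq_add_of_le' ht
  rfl

theorem active_anti {s t : ℕ} (hs : 1 ≤ s) (h : s ≤ t) :
    A.active μ k σ β ξ ω t ⊆ A.active μ k σ β ξ ω s := by
  induction t, h using Nat.le_induction with
  | base => exact subset_rfl
  | succ t hst ih =>
    rw [active_succ (hs.trans hst)]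
    split_ifs
    · exact (Finset.erase_subset _ _).trans ih
    · exact ih

/-- A prior that has been eliminated is never active again. -/
theorem Eliminates.notMem_active {s t : ℕ} (hs : 1 ≤ s) (h : A.Eliminates μ k σ β ξ s ω)
    (hst : s < t) : A.prior s ω ∉ A.active μ k σ β ξ ω t := by
  intro hmem
  have h1 := active_anti (by omega) (Nat.succ_le_of_lt hst) hmem
  rw [Nat.succ_eq_add_one, active_succ hs, if_pos h] at h1
  simp at h1

/-- The confidence bounds on which the regret bound rests, at the outcome `ω`. -/
structure Confident (A : Bandit Ω X P) (μ : P → X → ℝ) (k : P → X → X → ℝ) (σ : ℝ) (β ξ : ℕ → ℝ)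
    (T : ℕ) (pstar : P) (ω : Ω) : Prop where
  truth : ∀ t ∈ Finset.Icc 1 T, ∀ x,
    |A.f ω x - A.mean μ k σ t pstar ω x| ≤ √(β t) * √(A.var k σ t pstar ω x)
  sample : ∀ t ∈ Finset.Icc 1 T, ∀ p x,
    |A.sample t ω p x - A.mean μ k σ t p ω x| ≤ √(β t) * √(A.var k σ t p ω x)
  noise : ∀ p, ∀ t ≤ T, |∑ i ∈ A.rounds t p ω, A.noise i ω| ≤
    √(ξ (A.rounds t p ω).card * (A.rounds t p ω).card)
  selection : ∀ t ∈ Finset.Icc 1 T, (A.active μ k σ β ξ ω t).Nonempty →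
    A.prior t ω ∈ A.active μ k σ β ξ ω t ∧
      ∀ p ∈ A.active μ k σ β ξ ω t, ∀ x,
        A.sample t ω p x ≤ A.sample t ω (A.prior t ω) (A.arm t ω)

omit [Fintype P] in
theorem card_rounds_le (t : ℕ) (p : P) : (A.rounds t p ω).card ≤ t :=
  (Finset.card_filter_le _ _).trans (by simp)

namespace Confident

variable {T : ℕ} {pstar : P} (h : A.Confident μ k σ β ξ T pstar ω)
include h

/-- The confidence bound uses `ξ` at the number of selections, whereas the threshold uses `ξ t`; the
former is smaller since the count is at most `t`. A zero count lies outside the range of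
monotonicity, but then both sides vanish. -/
theorem noise_le (hξ : MonotoneOn ξ (Set.Ici 1)) (p : P) {t : ℕ} (ht : t ≤ T) :
    |∑ i ∈ A.rounds t p ω, A.noise i ω| ≤ √(ξ t * (A.rounds t p ω).card) := by
  refine (h.noise p t ht).trans ?_
  rcases Nat.eq_zero_or_pos (A.rounds t p ω).card with h0 | h0
  · simp [h0]
  · have h1 := card_rounds_le (A := A) (ω := ω) t p
    have h2 := hξ (Set.mem_Ici.2 h0) (Set.mem_Ici.2 (h0.trans_le h1)) h1
    gcongr

/-- The prior which generated the reward function is never eliminated. -/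
theorem pstar_mem_active (hξ : MonotoneOn ξ (Set.Ici 1)) {t : ℕ} (ht : 1 ≤ t) (htT : t ≤ T + 1) :
    pstar ∈ A.active μ k σ β ξ ω t := by
  induction t, ht using Nat.le_induction with
  | base => exact Finset.mem_univ _
  | succ t ht ih =>
    rw [active_succ ht]
    split_ifs with he
    · refine Finset.mem_erase.2 ⟨fun hp => ?_, ih (by omega)⟩
      rw [Eliminates, threshold, ← hp] at he
      refine absurd he (not_lt.2 ?_)
      -- For the true prior, a prediction error is estimation error plus noise; the two summands of
      -- the threshold bound these separately.
      have h1 : ∀ i ∈ A.rounds t pstar ω, A.predError μ k σ i ω =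
          (A.f ω (A.arm i ω) - A.mean μ k σ i pstar ω (A.arm i ω)) + A.noise i ω := by
        intro i hi
        rw [predError, reward, (mem_rounds.1 hi).2]
        ring
      rw [Finset.sum_congr rfl h1, Finset.sum_add_distrib, add_comm]
      refine (abs_add_le _ _).trans (add_le_add (h.noise_le hξ pstar (by omega)) ?_)
      refine (Finset.abs_sum_le_sum_abs _ _).trans (Finset.sum_le_sum fun i hi => ?_)
      have h2 := (mem_rounds.1 hi).1
      exact h.truth i (Finset.mem_Icc.2 ⟨h2.1, by omega⟩) _
    · exact ih (by omega)

theorem selection_spec (hξ : MonotoneOn ξ (Set.Ici 1)) {t : ℕ} (ht : t ∈ Finset.Icc 1 T) :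
    A.prior t ω ∈ A.active μ k σ β ξ ω t ∧
      ∀ x, A.sample t ω pstar x ≤ A.sample t ω (A.prior t ω) (A.arm t ω) := by
  obtain ⟨h1, h2⟩ := Finset.mem_Icc.1 ht
  have hp := h.pstar_mem_active hξ h1 (by omega)
  obtain ⟨h3, h4⟩ := h.selection t ht ⟨_, hp⟩
  exact ⟨h3, h4 _ hp⟩

/-- At `x` two widths are paid, from `f` to the posterior mean of `pstar` and from there to its
sample. The maximisation leads to the selected pair, where one more width reaches `μ_{t,p_t}(x_t) =
f(x_t) + ε_t - η_t`. The selected prior may be wrong, so `η_t` is left to the elimination test. -/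
theorem instant_regret_le (hξ : MonotoneOn ξ (Set.Ici 1)) {t : ℕ} (ht : t ∈ Finset.Icc 1 T)
    (x : X) : A.f ω x - A.f ω (A.arm t ω) ≤ 2 * (√(β t) * √(A.var k σ t pstar ω x)) +
      √(β t) * √(A.var k σ t (A.prior t ω) ω (A.arm t ω)) - A.predError μ k σ t ω +
      A.noise t ω := by
  have h1 := (abs_le.1 (h.truth t ht x)).2
  have h2 := (abs_le.1 (h.sample t ht pstar x)).1
  have h3 := (abs_le.1 (h.sample t ht (A.prior t ω) (A.arm t ω))).2
  have h4 := (h.selection_spec hξ ht).2 x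
  have h5 : A.predError μ k σ t ω = A.f ω (A.arm t ω) + A.noise t ω -
    A.mean μ k σ t (A.prior t ω) ω (A.arm t ω) := rfl
  linarith

open Classical in
/-- Every prior is eliminated at most once. -/
theorem card_eliminates_le (hξ : MonotoneOn ξ (Set.Ici 1)) :
    ((Finset.Icc 1 T).filter fun t => A.Eliminates μ k σ β ξ t ω).card ≤ Fintype.card P := by
  refine Finset.card_le_card_of_injOn (fun t => A.prior t ω) (fun _ _ => Finset.mem_univ _) ?_
  have key : ∀ s ∈ Finset.Icc 1 T, ∀ t ∈ Finset.Icc 1 T, A.Eliminates μ k σ β ξ s ω → s < t →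
      A.prior s ω ≠ A.prior t ω := by
    intro s hs t ht he hst heq
    have h1 := he.notMem_active (Finset.mem_Icc.1 hs).1 hst
    rw [heq] at h1
    exact h1 (h.selection_spec hξ ht).1
  intro s hs t ht heq
  rw [Finset.mem_coe, Finset.mem_filter] at hs ht
  rcases lt_trichotomy s t with hst | hst | hst
  · exact absurd heq (key s hs.1 t ht.1 hs.2 hst)
  · exact hst
  · exact absurd heq.symm (key t ht.1 s hs.1 ht.2 hst)

open Classical in
/-- In the rounds in which `p` is selected and survives, the elimination criterion bounds the sum
of the prediction errors. -/
theorem sum_predError_noise_le (hξ : MonotoneOn ξ (Set.Ici 1)) (p : P)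
    {G : Finset ℕ} (hG : G = ((Finset.Icc 1 T).filter
      fun t => ¬ A.Eliminates μ k σ β ξ t ω).filter fun t => A.prior t ω = p) :
    ∑ t ∈ G, (A.noise t ω - A.predError μ k σ t ω) ≤
      2 * √(ξ T * G.card) + ∑ t ∈ G, √(β t) * √(A.var k σ t p ω (A.arm t ω)) := by
  rcases G.eq_empty_or_nonempty with hemp | hne
  · simp [hemp]
  have hmem : ∀ {i}, i ∈ G ↔ (1 ≤ i ∧ i ≤ T) ∧ A.prior i ω = p ∧ ¬ A.Eliminates μ k σ β ξ i ω := by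
    intro i
    rw [hG, Finset.mem_filter, Finset.mem_filter, Finset.mem_Icc, and_assoc, and_comm (a := ¬ _)]
  let s := G.max' hne
  obtain ⟨⟨hs1, hsT⟩, hsp, hse⟩ := hmem.1 (G.max'_mem hne)
  -- At the last surviving round `s` of `p`, every earlier selection of `p` also survived, as `p` is
  -- still active at `s`. So the test passed at `s` concerns exactly the sum over `G`.
  have hr : A.rounds s p ω = G := by
    ext i
    rw [mem_rounds, hmem]
    constructor
    · rintro ⟨⟨h1, h2⟩, h3⟩
      refine ⟨⟨h1, by omega⟩, h3, fun he => ?_⟩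
      rcases h2.eq_or_lt with rfl | h2
      · exact hse he
      · have h4 := he.notMem_active h1 h2
        rw [h3, ← hsp] at h4
        exact h4 (h.selection_spec hξ (Finset.mem_Icc.2 ⟨hs1, hsT⟩)).1
    · rintro ⟨⟨h1, h2⟩, h3, h4⟩
      exact ⟨⟨h1, G.le_max' i (hmem.2 ⟨⟨h1, h2⟩, h3, h4⟩)⟩, h3⟩
  have hξs : √(ξ s * G.card) ≤ √(ξ T * G.card) := by
    have := hξ (Set.mem_Ici.2 hs1) (Set.mem_Ici.2 (hs1.trans hsT)) hsT
    gcongr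
  have h1 := (abs_le.1 (h.noise_le hξ p hsT)).2
  rw [hr] at h1
  change ¬ A.Eliminates μ k σ β ξ s ω at hse
  rw [Eliminates, threshold, not_lt, show A.prior s ω = p from hsp, hr] at hse
  have h2 := (abs_le.1 hse).1
  rw [Finset.sum_sub_distrib]
  linarith

variable [Fintype X]

/-- In round 1 there are no data, so the confidence bound compares `f` with the prior mean; `β 1 ≥
1` gives `√(β 1) ≤ β 1`. -/
theorem abs_f_le (hk_le : ∀ p x, k p x x ≤ 1) (hβ1 : 1 ≤ β 1) (hT : 1 ≤ T) (x : X) :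
    |A.f ω x| ≤ β 1 + ⨆ x, |μ pstar x| := by
  have hemp : IsEmpty (Finset.Ico 1 1) := ⟨fun i => by have := Finset.mem_Ico.1 i.2; omega⟩
  have h1 := h.truth 1 (Finset.mem_Icc.2 ⟨le_rfl, hT⟩) x
  have h2 : A.mean μ k σ 1 pstar ω x = μ pstar x := by
    simp [mean, postMean, dotProduct]
  have h3 : A.var k σ 1 pstar ω x = k pstar x x := by
    simp [var, kernel, postKernel, dotProduct]
  rw [h2, h3] at h1
  have h4 : √(β 1) * √(k pstar x x) ≤ β 1 * 1 := by
    gcongr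
    · exact Real.sqrt_le_left (by linarith) |>.2 (by nlinarith)
    · exact Real.sqrt_le_one.2 (hk_le pstar x)
  have h5 := le_ciSup (Finite.bddAbove_range fun x => |μ pstar x|) x
  have h6 := abs_sub_abs_le_abs_sub (A.f ω x) (μ pstar x)
  linarith

open Classical in
-- Eliminating rounds are charged `2 B` each; the others are split by selected prior into the sets
-- `G p`, whose sizes add up to at most `T`.
theorem regret_le (hk : ∀ p, (Matrix.of (k p)).PosSemidef) (hk_le : ∀ p x, k p x x ≤ 1)
    (hσ : 0 < σ) (hβ1 : 1 ≤ β 1) (hβ : MonotoneOn β (Set.Ici 1))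
    (hξ0 : ∀ t, 1 ≤ t → 0 ≤ ξ t) (hξ : MonotoneOn ξ (Set.Ici 1)) (hT : 1 ≤ T) (xs : X) :
    A.regret T xs ω ≤ 2 * Fintype.card P * (β 1 + ⨆ x, |μ pstar x|)
      + 2 * √(ξ T * Fintype.card P * T)
      + 2 * √(2 / Real.log (1 + (σ ^ 2)⁻¹) * T * β T * worstInfoGain μ k σ T * Fintype.card P)
      + 2 * √(T * β T * ∑ t ∈ Finset.Icc 1 T, A.var k σ t pstar ω xs) := by
  let C := 2 / Real.log (1 + (σ ^ 2)⁻¹)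
  let γ := worstInfoGain μ k σ T
  let B := β 1 + ⨆ x, |μ pstar x|
  let r : ℕ → ℝ := fun t => A.f ω xs - A.f ω (A.arm t ω)
  let a : ℕ → ℝ := fun t => √(A.var k σ t pstar ω xs)
  let S := (Finset.Icc 1 T).filter fun t => ¬ A.Eliminates μ k σ β ξ t ω
  let G : P → Finset ℕ := fun p => S.filter fun t => A.prior t ω = p
  have hvar : ∀ t p x, 0 ≤ A.var k σ t p ω x := fun t p x =>
    (postKernel_posSemidef (hk p) hσ fun i : Finset.Ico 1 t => A.arm i ω).diag_nonneg (i := x)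
  have hβT : ∀ t ∈ Finset.Icc 1 T, √(β t) ≤ √(β T) := fun t ht => by
    obtain ⟨h1, h2⟩ := Finset.mem_Icc.1 ht
    exact Real.sqrt_le_sqrt (hβ (Set.mem_Ici.2 h1) (Set.mem_Ici.2 hT) h2)
  have hβ0 : 0 ≤ β T := by linarith [hβ (Set.mem_Ici.2 le_rfl) (Set.mem_Ici.2 hT) hT]
  have hξT : 0 ≤ ξ T := hξ0 T hT
  have hGS : ∀ {p t}, t ∈ G p → t ∈ Finset.Icc 1 T ∧ A.prior t ω = p := fun ht => by
    obtain ⟨h1, h2⟩ := Finset.mem_filter.1 ht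
    exact ⟨(Finset.mem_filter.1 h1).1, h2⟩
  have hC : 0 ≤ C := div_nonneg zero_le_two (Real.log_nonneg (by
    have : 0 ≤ (σ ^ 2)⁻¹ := by positivity
    linarith))
  -- Every posterior conditions on all past rounds, whichever prior was selected. The sum is
  -- therefore enlarged to all rounds before the information gain of `p` is applied.
  have hgain : ∀ p, ∑ t ∈ G p, A.var k σ t p ω (A.arm t ω) ≤ C * γ := by
    intro p
    calc ∑ t ∈ G p, A.var k σ t p ω (A.arm t ω)
        ≤ ∑ t ∈ Finset.Icc 1 T, A.var k σ t p ω (A.arm t ω) :=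
          Finset.sum_le_sum_of_subset_of_nonneg (fun t ht => (hGS ht).1) fun t _ _ => hvar t p _
      _ ≤ C * maxInfoGain (μ p) (k p) σ T :=
          sum_postKernel_le (μ p) (hk p) (hk_le p) hσ (fun t => A.arm t ω) T
      _ ≤ C * γ := mul_le_mul_of_nonneg_left
          (le_ciSup (Finite.bddAbove_range fun p => maxInfoGain (μ p) (k p) σ T) p) hC
  have hCγ : 0 ≤ C * γ := (Finset.sum_nonneg fun t _ => hvar t pstar _).trans (hgain pstar)
  have hcard : ∑ p, ((G p).card : ℝ) ≤ T := by
    rw [← Nat.cast_sum, Finset.sum_card_fiberwise_eq_card_filter]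
    refine Nat.cast_le.2 ((Finset.card_filter_le _ _).trans ((Finset.card_filter_le _ _).trans ?_))
    simp
  have hB : ∀ t, r t ≤ 2 * B := by
    intro t
    have h1 := (abs_le.1 (h.abs_f_le hk_le hβ1 hT xs)).2
    have h2 := (abs_le.1 (h.abs_f_le hk_le hβ1 hT (A.arm t ω))).1
    change _ - _ ≤ 2 * (β 1 + ⨆ x, |μ pstar x|)
    linarith
  have hB0 : 0 ≤ B := add_nonneg (by linarith) (Real.iSup_nonneg fun _ => abs_nonneg _)
  have helim : ∑ t ∈ (Finset.Icc 1 T).filter (fun t => A.Eliminates μ k σ β ξ t ω), r t ≤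
      2 * Fintype.card P * B := by
    refine (Finset.sum_le_card_nsmul _ _ _ fun t _ => hB t).trans ?_
    have h1 : (((Finset.Icc 1 T).filter fun t => A.Eliminates μ k σ β ξ t ω).card : ℝ) ≤
      Fintype.card P := by exact_mod_cast h.card_eliminates_le hξ
    rw [nsmul_eq_mul]
    nlinarith
  -- The factor 2 in the last term collects one width from the instantaneous regret and one from the
  -- threshold.
  have hG : ∀ p, ∑ t ∈ G p, r t ≤ 2 * √(β T) * ∑ t ∈ G p, a t + 2 * √(ξ T * (G p).card) +
      2 * √(β T) * √((G p).card * (C * γ)) := by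
    intro p
    have h1 : ∑ t ∈ G p, r t ≤ ∑ t ∈ G p, (2 * √(β T) * a t +
        √(β T) * √(A.var k σ t p ω (A.arm t ω)) +
        (A.noise t ω - A.predError μ k σ t ω)) := by
      refine Finset.sum_le_sum fun t ht => ?_
      obtain ⟨h1, h2⟩ := hGS ht
      have h3 := h.instant_regret_le hξ h1 xs
      rw [h2] at h3
      have h4 := mul_le_mul_of_nonneg_right (hβT t h1) (Real.sqrt_nonneg (A.var k σ t pstar ω xs))
      have h5 := mul_le_mul_of_nonneg_right (hβT t h1)
        (Real.sqrt_nonneg (A.var k σ t p ω (A.arm t ω)))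
      simp only [r, a]
      linarith
    rw [Finset.sum_add_distrib, Finset.sum_add_distrib, ← Finset.mul_sum, ← Finset.mul_sum] at h1
    have h2 := h.sum_predError_noise_le hξ p (G := G p) rfl
    have h3 : ∑ t ∈ G p, √(β t) * √(A.var k σ t p ω (A.arm t ω)) ≤
        √(β T) * ∑ t ∈ G p, √(A.var k σ t p ω (A.arm t ω)) := by
      rw [Finset.mul_sum]
      exact Finset.sum_le_sum fun t ht =>
        mul_le_mul_of_nonneg_right (hβT t (hGS ht).1) (Real.sqrt_nonneg _)
    have h4 : ∑ t ∈ G p, √(A.var k σ t p ω (A.arm t ω)) ≤ √((G p).card * (C * γ)) :=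
      (sum_sqrt_le _ fun t => hvar t p _).trans (Real.sqrt_le_sqrt
        (mul_le_mul_of_nonneg_left (hgain p) (Nat.cast_nonneg _)))
    have h5 := mul_le_mul_of_nonneg_left h4 (Real.sqrt_nonneg (β T))
    linarith
  have hS : ∑ t ∈ S, r t ≤ 2 * √(β T) * ∑ t ∈ S, a t + 2 * ∑ p, √(ξ T * (G p).card) +
      2 * √(β T) * ∑ p, √((G p).card * (C * γ)) := by
    rw [← Finset.sum_fiberwise S (fun t => A.prior t ω) r,
      ← Finset.sum_fiberwise S (fun t => A.prior t ω) a, Finset.mul_sum, Finset.mul_sum,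
      Finset.mul_sum, ← Finset.sum_add_distrib, ← Finset.sum_add_distrib]
    exact Finset.sum_le_sum fun p _ => hG p
  have h1 : ∑ p, √(ξ T * (G p).card) ≤ √(ξ T * Fintype.card P * T) := by
    refine (sum_sqrt_le _ fun p => by positivity).trans (Real.sqrt_le_sqrt ?_)
    rw [← Finset.mul_sum, Finset.card_univ]
    calc (Fintype.card P : ℝ) * (ξ T * ∑ p, ((G p).card : ℝ))
        ≤ Fintype.card P * (ξ T * T) := by gcongr
      _ = ξ T * Fintype.card P * T := by ring
  have h2 : √(β T) * ∑ p, √((G p).card * (C * γ)) ≤ √(C * T * β T * γ * Fintype.card P) := by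
    rw [show C * T * β T * γ * Fintype.card P = β T * (Fintype.card P * (T * (C * γ))) by ring,
      Real.sqrt_mul hβ0]
    refine mul_le_mul_of_nonneg_left ?_ (Real.sqrt_nonneg _)
    refine (sum_sqrt_le _ fun p => by positivity).trans (Real.sqrt_le_sqrt ?_)
    rw [← Finset.sum_mul, Finset.card_univ]
    gcongr
  have h3 : √(β T) * ∑ t ∈ S, a t ≤
      √(T * β T * ∑ t ∈ Finset.Icc 1 T, A.var k σ t pstar ω xs) := by
    rw [mul_comm (T : ℝ), mul_assoc, Real.sqrt_mul hβ0]
    refine mul_le_mul_of_nonneg_left ?_ (Real.sqrt_nonneg _)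
    calc ∑ t ∈ S, a t ≤ ∑ t ∈ Finset.Icc 1 T, a t :=
          Finset.sum_le_sum_of_subset_of_nonneg (Finset.filter_subset _ _)
            fun t _ _ => Real.sqrt_nonneg _
      _ ≤ _ := by simpa using sum_sqrt_le (Finset.Icc 1 T) fun t => hvar t pstar xs
  have h4 : A.regret T xs ω = ∑ t ∈ (Finset.Icc 1 T).filter
      (fun t => A.Eliminates μ k σ β ξ t ω), r t + ∑ t ∈ S, r t :=
    (Finset.sum_filter_add_sum_filter_not _ _ _).symm
  rw [h4]
  linarith

end Confident

end Bandit


/-! ### The parameters of the algorithm and the union bound -/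

/-- The factor `π²/6` is the value of `∑ 1/t²`, which accounts for `π²` in the parameters. -/
theorem measure_biUnion_le_of_div_sq {Ω ι : Type*} [Fintype ι] [MeasurableSpace Ω]
    (Pr : Measure Ω) (T : ℕ) {D : ℕ → ι → Set Ω} {c : ℝ} (hc : 0 ≤ c)
    (hD : ∀ t ∈ Finset.Icc 1 T, ∀ i, Pr (D t i) ≤ ENNReal.ofReal (c / t ^ 2)) :
    Pr (⋃ t ∈ Finset.Icc 1 T, ⋃ i, D t i) ≤
      ENNReal.ofReal (Fintype.card ι * c * (Real.pi ^ 2 / 6)) := by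
  calc Pr (⋃ t ∈ Finset.Icc 1 T, ⋃ i, D t i)
      ≤ ∑ t ∈ Finset.Icc 1 T, Pr (⋃ i, D t i) := measure_biUnion_finset_le _ _
    _ ≤ ∑ t ∈ Finset.Icc 1 T, ENNReal.ofReal (Fintype.card ι * c * (1 / (t : ℝ) ^ 2)) := by
        refine Finset.sum_le_sum fun t ht => ?_
        refine (measure_iUnion_fintype_le _ _).trans
          ((Finset.sum_le_sum fun i _ => hD t ht i).trans ?_)
        rw [Finset.sum_const, Finset.card_univ, nsmul_eq_mul, ← ENNReal.ofReal_natCast,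
          ← ENNReal.ofReal_mul (Nat.cast_nonneg _)]
        exact (congrArg ENNReal.ofReal (by ring)).le
    _ = ENNReal.ofReal (∑ t ∈ Finset.Icc 1 T, Fintype.card ι * c * (1 / (t : ℝ) ^ 2)) :=
        (ENNReal.ofReal_sum_of_nonneg fun t _ => by positivity).symm
    _ ≤ _ := by
        rw [← Finset.mul_sum]
        gcongr
        exact sum_le_hasSum _ (fun t _ => by positivity) hasSum_zeta_two

section Parameters

variable {X P : Type*} [Fintype X] [Fintype P] {σ δ : ℝ}

theorem nine_le_pi_sq : 9 ≤ Real.pi ^ 2 := by nlinarith [Real.pi_gt_three]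

/-- From `π² ≥ 9` and `δ < 1`. As `3 > e`, the logarithms in `beta` and `xi` are at least 1. -/
theorem three_le_ratio [Nonempty P] (hδ0 : 0 < δ) (hδ1 : δ < 1) {t : ℕ} (ht : 1 ≤ t) :
    3 ≤ Fintype.card P * Real.pi ^ 2 * t ^ 2 / (3 * δ) := by
  have h1 : (1 : ℝ) ≤ Fintype.card P := by exact_mod_cast Fintype.card_pos
  have h2 : (1 : ℝ) ≤ t := by exact_mod_cast ht
  rw [le_div_iff₀ (by positivity)]
  calc 3 * (3 * δ) ≤ 9 := by linarith
    _ ≤ 1 * Real.pi ^ 2 * 1 ^ 2 := by linarith [nine_le_pi_sq]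
    _ ≤ _ := by gcongr

theorem beta_ratio_eq (t : ℕ) :
    2 * Fintype.card X * Fintype.card P * Real.pi ^ 2 * t ^ 2 / (3 * δ) =
    2 * Fintype.card X * (Fintype.card P * Real.pi ^ 2 * t ^ 2 / (3 * δ)) := by ring

theorem three_le_beta_ratio [Nonempty X] [Nonempty P] (hδ0 : 0 < δ) (hδ1 : δ < 1) {t : ℕ}
    (ht : 1 ≤ t) : 3 ≤ 2 * Fintype.card X * Fintype.card P * Real.pi ^ 2 * t ^ 2 / (3 * δ) := by
  have h1 : (1 : ℝ) ≤ Fintype.card X := by exact_mod_cast Fintype.card_pos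
  have h2 := three_le_ratio (P := P) hδ0 hδ1 ht
  rw [beta_ratio_eq]
  nlinarith

theorem one_le_log_of_three_le {x : ℝ} (hx : 3 ≤ x) : 1 ≤ Real.log x := by
  rw [Real.le_log_iff_exp_le (by linarith)]
  linarith [Real.exp_one_lt_d9]

theorem one_le_beta [Nonempty X] [Nonempty P] (hδ0 : 0 < δ) (hδ1 : δ < 1) {t : ℕ} (ht : 1 ≤ t) :
    1 ≤ beta X P δ t := by
  have := one_le_log_of_three_le (three_le_beta_ratio (X := X) (P := P) hδ0 hδ1 ht)
  rw [beta]
  linarith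

theorem monotoneOn_beta [Nonempty X] [Nonempty P] (hδ0 : 0 < δ) (hδ1 : δ < 1) :
    MonotoneOn (beta X P δ) (Set.Ici 1) := by
  intro s hs t ht hst
  have := three_le_beta_ratio (X := X) (P := P) hδ0 hδ1 hs
  rw [beta, beta]
  gcongr

theorem xi_nonneg [Nonempty P] (hδ0 : 0 < δ) (hδ1 : δ < 1) {t : ℕ} (ht : 1 ≤ t) :
    0 ≤ xi P σ δ t := by
  have := one_le_log_of_three_le (three_le_ratio (P := P) hδ0 hδ1 ht)
  rw [xi]
  positivity

theorem monotoneOn_xi [Nonempty P] (hδ0 : 0 < δ) (hδ1 : δ < 1) :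
    MonotoneOn (xi P σ δ) (Set.Ici 1) := by
  intro s hs t ht hst
  have := three_le_ratio (P := P) hδ0 hδ1 hs
  rw [xi, xi]
  gcongr

theorem exp_neg_beta [Nonempty X] [Nonempty P] (hδ0 : 0 < δ) (hδ1 : δ < 1) {t : ℕ} (ht : 1 ≤ t) :
    Real.exp (-√(beta X P δ t) ^ 2 / 2) =
      3 * δ / (2 * Fintype.card X * Fintype.card P * Real.pi ^ 2) / t ^ 2 := by
  have h1 := three_le_beta_ratio (X := X) (P := P) hδ0 hδ1 ht
  rw [Real.sq_sqrt (zero_le_one.trans (one_le_beta hδ0 hδ1 ht)), beta, neg_div,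
    mul_div_cancel_left₀ _ two_ne_zero, Real.exp_neg, Real.exp_log (by linarith), inv_div,
    div_div]

theorem exp_neg_xi [Nonempty P] (hσ : 0 < σ) (hδ0 : 0 < δ) (hδ1 : δ < 1) {t : ℕ} (ht : 1 ≤ t) :
    Real.exp (-(√(xi P σ δ t) / σ) ^ 2 / 2) =
      3 * δ / (Fintype.card P * Real.pi ^ 2) / t ^ 2 := by
  have h1 := three_le_ratio (P := P) hδ0 hδ1 ht
  rw [div_pow, Real.sq_sqrt (xi_nonneg hδ0 hδ1 ht), xi, neg_div, div_div, mul_comm (σ ^ 2) 2,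
    mul_div_cancel_left₀ _ (by positivity), Real.exp_neg, Real.exp_log (by linarith), inv_div,
    div_div]

end Parameters

namespace IsRun

variable {Ω X P : Type*} [Fintype X] [DecidableEq X] [Fintype P] [DecidableEq P]
    [mΩ : MeasurableSpace Ω] {Pr : Measure Ω} [IsProbabilityMeasure Pr] {μ : P → X → ℝ}
    {k : P → X → X → ℝ} {σ δ : ℝ} {T : ℕ} {pstar : P} {A : Bandit Ω X P}
    (hA : IsRun Pr μ k σ (beta X P δ) (xi P σ δ) T pstar A)
include hA

/-- The confidence bounds hold with probability at least `1 - δ`. -/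
theorem measure_not_confident_le (hk : ∀ p, (Matrix.of (k p)).PosSemidef) (hσ : 0 < σ)
    (hδ0 : 0 < δ) (hδ1 : δ < 1) :
    Pr {ω | ¬ A.Confident μ k σ (beta X P δ) (xi P σ δ) T pstar ω} ≤ ENNReal.ofReal δ := by
  obtain ⟨ω₀⟩ : Nonempty Ω := nonempty_of_isProbabilityMeasure Pr
  have : Nonempty X := ⟨A.arm 0 ω₀⟩
  have : Nonempty P := ⟨pstar⟩
  have hX : (1 : ℝ) ≤ Fintype.card X := by exact_mod_cast Fintype.card_pos
  have hP : (1 : ℝ) ≤ Fintype.card P := by exact_mod_cast Fintype.card_pos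
  let D₁ : ℕ → X → Set Ω := fun t x => {ω | √(beta X P δ t) * √(A.var k σ t pstar ω x) <
    |A.f ω x - A.mean μ k σ t pstar ω x|}
  let D₂ : ℕ → P × X → Set Ω := fun t q => {ω | √(beta X P δ t) * √(A.var k σ t q.1 ω q.2) <
    |A.sample t ω q.1 q.2 - A.mean μ k σ t q.1 ω q.2|}
  -- Here the union bound runs over the number `n` of selections. In units of the standard deviation
  -- `√(n σ²)` the level is `√(ξ n) / σ`, so that `σ` cancels and `√(ξ n * n)` remains.
  let D₃ : ℕ → P → Set Ω := fun n p => {ω | ∃ t ≤ T, (A.rounds t p ω).card = n ∧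
    √(xi P σ δ n) / σ * √(n * σ ^ 2) < |∑ i ∈ A.rounds t p ω, A.noise i ω|}
  have h1 := measure_biUnion_le_of_div_sq Pr T (D := D₁)
    (c := 3 * δ / (2 * Fintype.card X * Fintype.card P * Real.pi ^ 2)) (by positivity)
    fun t ht x => by
      rw [← exp_neg_beta hδ0 hδ1 (Finset.mem_Icc.1 ht).1]
      exact hA.measure_truth_tail_le hk hσ ht x (Real.sqrt_nonneg _)
  have h2 := measure_biUnion_le_of_div_sq Pr T (D := D₂)
    (c := 3 * δ / (2 * Fintype.card X * Fintype.card P * Real.pi ^ 2)) (by positivity)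
    fun t ht q => by
      rw [← exp_neg_beta hδ0 hδ1 (Finset.mem_Icc.1 ht).1]
      exact hA.measure_sample_tail_le hk hσ ht q.1 q.2 (Real.sqrt_nonneg _)
  have h3 := measure_biUnion_le_of_div_sq Pr T (D := D₃)
    (c := 3 * δ / (Fintype.card P * Real.pi ^ 2)) (by positivity)
    fun n hn p => by
      rw [← exp_neg_xi hσ hδ0 hδ1 (Finset.mem_Icc.1 hn).1]
      exact hA.measure_noise_tail_le p n (by positivity)
  have h4 : Pr {ω | ¬ ∀ t ∈ Finset.Icc 1 T,
      (A.active μ k σ (beta X P δ) (xi P σ δ) ω t).Nonempty →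
      A.prior t ω ∈ A.active μ k σ (beta X P δ) (xi P σ δ) ω t ∧
        ∀ p ∈ A.active μ k σ (beta X P δ) (xi P σ δ) ω t, ∀ x,
          A.sample t ω p x ≤ A.sample t ω (A.prior t ω) (A.arm t ω)} = 0 :=
    ae_iff.1 ((ae_ball_iff (Finset.countable_toSet _)).2 hA.selection)
  have hsub : {ω | ¬ A.Confident μ k σ (beta X P δ) (xi P σ δ) T pstar ω} ⊆
      (⋃ t ∈ Finset.Icc 1 T, ⋃ x, D₁ t x) ∪ (⋃ t ∈ Finset.Icc 1 T, ⋃ q, D₂ t q) ∪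
      (⋃ n ∈ Finset.Icc 1 T, ⋃ p, D₃ n p) ∪ {ω | ¬ ∀ t ∈ Finset.Icc 1 T,
      (A.active μ k σ (beta X P δ) (xi P σ δ) ω t).Nonempty →
      A.prior t ω ∈ A.active μ k σ (beta X P δ) (xi P σ δ) ω t ∧
        ∀ p ∈ A.active μ k σ (beta X P δ) (xi P σ δ) ω t, ∀ x,
          A.sample t ω p x ≤ A.sample t ω (A.prior t ω) (A.arm t ω)} := by
    intro ω hω
    by_contra hn
    simp only [Set.mem_union, Set.mem_iUnion, not_or, not_exists, Set.mem_ofPred_eq,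
      not_not] at hn
    obtain ⟨⟨⟨n1, n2⟩, n3⟩, n4⟩ := hn
    refine hω ⟨fun t ht x => not_lt.1 (n1 t ht x), fun t ht p x => not_lt.1 (n2 t ht (p, x)),
      fun p t ht => ?_, n4⟩
    rcases Nat.eq_zero_or_pos (A.rounds t p ω).card with h0 | h0
    · rw [Finset.card_eq_zero.1 h0]
      simp
    · have hle := (Bandit.card_rounds_le (A := A) (ω := ω) t p).trans ht
      have h5 := n3 _ (Finset.mem_Icc.2 ⟨h0, hle⟩) p
      have h6 : |∑ i ∈ A.rounds t p ω, A.noise i ω| ≤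
          √(xi P σ δ (A.rounds t p ω).card) / σ * √((A.rounds t p ω).card * σ ^ 2) :=
        not_lt.1 fun hlt => h5 ⟨t, ht, rfl, hlt⟩
      rwa [Real.sqrt_mul (Nat.cast_nonneg _), Real.sqrt_sq hσ.le, ← mul_assoc, mul_right_comm,
        div_mul_cancel₀ _ hσ.ne', ← Real.sqrt_mul (xi_nonneg hδ0 hδ1 h0)] at h6
  calc _ ≤ _ := measure_mono hsub
    _ ≤ _ := measure_union_le _ _
    _ ≤ _ := add_le_add_left ((measure_union_le _ _).trans
      (add_le_add ((measure_union_le _ _).trans (add_le_add h1 h2)) h3)) _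
    _ ≤ ENNReal.ofReal δ := by
      rw [h4, add_zero, ← ENNReal.ofReal_add (by positivity) (by positivity),
        ← ENNReal.ofReal_add (by positivity) (by positivity)]
      apply ENNReal.ofReal_le_ofReal
      have hπ := Real.pi_pos
      -- The failure budget: `δ / (4 |P|)` for `f`, which needs only the prior `pstar`, `δ / 4` for
      -- the samples and `δ / 2` for the noise.
      have e1 : Fintype.card X * (3 * δ / (2 * Fintype.card X * Fintype.card P * Real.pi ^ 2)) *
          (Real.pi ^ 2 / 6) = δ / (4 * Fintype.card P) := by
        field_simp
        norm_num
      have e2 : (Fintype.card (P × X) : ℝ) *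
          (3 * δ / (2 * Fintype.card X * Fintype.card P * Real.pi ^ 2)) *
          (Real.pi ^ 2 / 6) = δ / 4 := by
        rw [Fintype.card_prod]
        push_cast
        field_simp
        norm_num
      have e3 : Fintype.card P * (3 * δ / (Fintype.card P * Real.pi ^ 2)) *
          (Real.pi ^ 2 / 6) = δ / 2 := by
        field_simp
        norm_num
      have e4 : δ / (4 * Fintype.card P) ≤ δ / 4 := by
        gcongr
        linarith
      rw [e1, e2, e3]
      linarith

end IsRun

end

end PEGPTS

/-! ### The regret bound -/

theorem mainTheorem1 {Ω X P : Type*} [Fintype X] [DecidableEq X] [Fintype P] [DecidableEq P]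
    [MeasurableSpace Ω] (Pr : Measure Ω) [IsProbabilityMeasure Pr]
    (μ : P → X → ℝ) (k : P → X → X → ℝ)
    (hk : ∀ p, (Matrix.of (k p)).PosSemidef) (hk_le : ∀ p x, k p x x ≤ 1)
    (σ : ℝ) (hσ : 0 < σ) (δ : ℝ) (hδ0 : 0 < δ) (hδ1 : δ < 1) (T : ℕ) (pstar : P)
    (A : PEGPTS.Bandit Ω X P)
    (hA : PEGPTS.IsRun Pr μ k σ (PEGPTS.beta X P δ) (PEGPTS.xi P σ δ) T pstar A)
    (B C γ : ℝ)
    (hB : B = PEGPTS.beta X P δ 1 + ⨆ x, |μ pstar x|)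
    (hC : C = 2 / Real.log (1 + (σ ^ 2)⁻¹))
    (hγ : γ = PEGPTS.worstInfoGain μ k σ T) :
    1 - δ ≤ Pr.real {ω | ∀ xs : X, (∀ x, A.f ω x ≤ A.f ω xs) →
      A.regret T xs ω ≤
        2 * Fintype.card P * B
        + 2 * √(PEGPTS.xi P σ δ T * Fintype.card P * T)
        + 2 * √(C * T * PEGPTS.beta X P δ T * γ * Fintype.card P)
        + 2 * √(T * PEGPTS.beta X P δ T *
            ∑ t ∈ Finset.Icc 1 T, A.var k σ t pstar ω xs)} := by
  subst hB hC hγ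
  obtain ⟨ω₀⟩ : Nonempty Ω := nonempty_of_isProbabilityMeasure Pr
  have : Nonempty X := ⟨A.arm 0 ω₀⟩
  have : Nonempty P := ⟨pstar⟩
  have hβ1 := PEGPTS.one_le_beta (X := X) (P := P) hδ0 hδ1 le_rfl
  have hbad : Pr.real {ω | ¬ A.Confident μ k σ (PEGPTS.beta X P δ) (PEGPTS.xi P σ δ) T pstar ω} ≤
      δ := ENNReal.toReal_le_of_le_ofReal hδ0.le (hA.measure_not_confident_le hk hσ hδ0 hδ1)
  -- Subadditivity avoids any question of measurability of the confidence event.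
  have hunion : 1 ≤
      Pr.real {ω | A.Confident μ k σ (PEGPTS.beta X P δ) (PEGPTS.xi P σ δ) T pstar ω} +
      Pr.real {ω | ¬ A.Confident μ k σ (PEGPTS.beta X P δ) (PEGPTS.xi P σ δ) T pstar ω} := by
    rw [← probReal_univ (μ := Pr), ← Set.union_compl_self
      {ω | A.Confident μ k σ (PEGPTS.beta X P δ) (PEGPTS.xi P σ δ) T pstar ω}]
    exact measureReal_union_le _ _
  refine (show 1 - δ ≤ Pr.real
    {ω | A.Confident μ k σ (PEGPTS.beta X P δ) (PEGPTS.xi P σ δ) T pstar ω} by linarith).trans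
    (measureReal_mono ?_)
  intro ω hω xs _
  -- For `T = 0` there is no first round to bound `f`, but the regret is an empty sum.
  rcases Nat.eq_zero_or_pos T with rfl | hT
  · have hB : 0 ≤ ⨆ x, |μ pstar x| := Real.iSup_nonneg fun _ => abs_nonneg _
    have hregret : A.regret 0 xs ω = 0 := by simp [PEGPTS.Bandit.regret]
    rw [hregret]
    positivity
  · exact hω.regret_le hk hk_le hσ hβ1 (PEGPTS.monotoneOn_beta hδ0 hδ1)
      (fun t ht => PEGPTS.xi_nonneg hδ0 hδ1 ht) (PEGPTS.monotoneOn_xi hδ0 hδ1) hT xs
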